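/- Let $k$ be a field of characteristic $0$ (e.g. $\mathbb{R}$ or $\mathbb{C}$) and $n \ge 0$. Let $W_n$ be the Lie algebra of formal vector fields $\sum_i f^i\partial_i$ over $k$ in $x^1,\dots,x^n$, let $\mathfrak{s} = \langle e_i=\partial_i,\ e_i^j=x^j\partial_i\rangle$ and let $\mathfrak{n}$ be the subalgebra of the vector fields vanishing to second order at $0$, so that $W_n=\mathfrak{s}\bowtie\mathfrak{n}$. Let $\Omega_n^{\le 1}=\Omega^0_n\oplus\Omega^1_n$ be the formal differential forms of degree at most one, with the product $(a+\alpha)(b+\beta)=ab+a\beta+b\alpha$ for $0$-forms $a,b$ and $1$-forms $\alpha,\beta$. Let $\mathcal{F}=\mathcal{F}(N)$ be the Hopf algebra of regular functions on the group $N$ of diffeomorphisms $\psi$ with $\psi(0)=0$, $\psi'(0)=\mathrm{Id}$, i.e. the polynomial algebra in the coordinates $\alpha^i_{K}(\psi)=\partial^K\psi^i(0)$, $|K|\ge2$, with $\Delta f(\varphi,\psi)=f(\varphi\circ\psi)$, $\varepsilon(f)=f(\mathrm{id})$, $Sf(\psi)=f(\psi^{-1})$. It coacts on $\Omega_n^{\le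 1}$ from the right, $\omega\mapsto\omega_{\langle0\rangle}\otimes\omega_{\langle1\rangle}$, $\omega_{\langle0\rangle}\,\omega_{\langle1\rangle}(\psi)=(\psi^{-1})^*\omega$, and on $\wedge^\bullet\mathfrak{s}^*$ from the left, $\eta\mapsto\eta_{\langle-1\rangle}\otimes\eta_{\langle0\rangle}$, multiplicatively, by $\theta^i\mapsto1\otimes\theta^i$, $\theta^i_j\mapsto1\otimes\theta^i_j+\sum_l\eta^i_{jl}\otimes\theta^l$, where $\{\theta^i,\theta^i_j\}$ is the basis dual to $\{e_i,e_i^j\}$ and $\eta^i_{jl}(\psi)=\partial_j\partial_l\psi^i(0)$. For $\xi\in\mathfrak{n}$ and $f\in\mathcal F$ let $\langle\xi,f\rangle=\frac{d}{dt}\big|_{t=0}f(\exp(-t\xi))$. Let $C^{p,q}=\Omega_n^{\le1}\otimes\wedge^p\mathfrak{s}^*\otimes\mathcal{F}^{\otimes q}$, the tensor product with $\Omega_n^{\le1}$ being completed (formal forms with coefficients in $\wedge^p\mathfrak{s}^*\otimes\mathcal{F}^{\otimes q}$), with the product $C^{p,q}\times C^{p',q'}\to C^{p+p',q+q'}$ $$(a\otimes\eta\otimes\tilde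 f)*(\omega\otimes\zeta\otimes\tilde g)=(-1)^{qp'}\,a_{\langle0\rangle}\omega\otimes\eta_{\langle0\rangle}\wedge\zeta\otimes\tilde f\otimes S(a_{\langle1\rangle})\eta_{\langle-1\rangle}\cdot\tilde g,$$ where $h\cdot(g^1\otimes\cdots\otimes g^{q'})=h_{(1)}g^1\otimes\cdots\otimes h_{(q')}g^{q'}$ (and $h\cdot 1=\varepsilon(h)$ if $q'=0$). Let $\mathcal V$ be the van Est type map from $C^{p,q}$ to the $\Omega_n^{\le1}$-valued cochains on $\wedge^p\mathfrak{s}\otimes\wedge^q\mathfrak{n}$, $$\mathcal V(\omega\otimes\eta\otimes f^1\otimes\cdots\otimes f^q)(X_1,\dots,X_p\mid\xi_1,\dots,\xi_q)=\eta(X_1,\dots,X_p)\sum_{\sigma\in S_q}(-1)^\sigma\langle\xi_{\sigma(1)},f^1\rangle\cdots\langle\xi_{\sigma(q)},f^q\rangle\,\omega .$$ Let $\natural(\Phi)(X_1,\dots,X_p\mid\xi_1,\dots,\xi_q)=\Phi(X_1,\dots,X_p,\xi_1,\dots,\xi_q)$ be the isomorphism from the cochains $C^m(W_n,\Omega_n^{\le1})=\mathrm{Hom}(\wedge^mW_n,\Omega_n^{\le1})$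 to the total complex $\mathrm{Tot}^m(\Omega_n^{\le 1},\mathfrak{s}^*,\mathfrak{n}^*)$, whose elements have one component for each bidegree $(p,q)$ with $p+q=m$, and let $\Phi\cup\Phi'=\natural(\natural^{-1}\Phi\cup\natural^{-1}\Phi')$, where on $C^*(W_n,\Omega_n^{\le1})$ the cup product is the signed sum over shuffles, with values multiplied in $\Omega_n^{\le1}$. Call $y\in C^{p',q'}$ normalized if its coefficients lie in $\wedge^{p'}\mathfrak{s}^*\otimes(\ker\varepsilon)^{\otimes q'}$. Then $\mathcal V$ is multiplicative: for every $x\in C^{p,q}$ and every normalized $y\in C^{p',q'}$, $$\mathcal V(x*y)=\mathcal V(x)\cup\mathcal V(y)\quad\text{in }\mathrm{Tot}^{p+q+p'+q'}(\Omega_n^{\le 1},\mathfrak{s}^*,\mathfrak{n}^*),$$ and in particular $$\mathcal V\big((a\otimes\eta\otimes\tilde f)*(\omega\otimes\zeta\otimes g^1\otimes\cdots\otimes g^{q'})\big)=\mathcal V(a\otimes\eta\otimes\tilde f)\cup\mathcal V(\omega\otimes\zeta\otimes g^1\otimes\cdots\otimes g^{q'})$$ whenever $\varepsilon(g^1)=\dots=\varepsilon(g^{q'})=0$.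 -/

import Mathlib

open scoped TensorProduct

noncomputable section

namespace VanEst

/-! ### The Lie algebra of formal vector fields -/

section FormalVectorFields

variable (k : Type*) [Field k] (n : ℕ)

/-- The space `W_n` of formal vector fields `∑ i, f i ∂_i`, where each `f i` is a formal power
series in `x_1, …, x_n`; the vector field is stored as the tuple of its components. -/
def W : Type _ := Fin n → MvPowerSeries (Fin n) k

instance : AddCommGroup (W k n) := inferInstanceAs (AddCommGroup (Fin n → MvPowerSeries (Fin n) k))
instance : Module k (W k n) := inferInstanceAs (Module k (Fin n → MvPowerSeries (Fin n) k))

variable {k n}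

/-- The derivation `∑ j, (X j) ∂_j` of the ring of formal power series given by a formal vector
field. -/
def W.der (X : W k n) : Derivation k (MvPowerSeries (Fin n) k) (MvPowerSeries (Fin n) k) :=
  ∑ j, X j • MvPowerSeries.pderiv k j

/-- The bracket of vector fields, `[X, Y]^i = X(Y^i) - Y(X^i)`. -/
instance : Bracket (W k n) (W k n) := ⟨fun X Y i => X.der (Y i) - Y.der (X i)⟩

theorem W.bracket_apply (X Y : W k n) (i : Fin n) : ⁅X, Y⁆ i = X.der (Y i) - Y.der (X i) := rfl

@[simp] theorem W.add_apply (X Y : W k n) (i : Fin n) : (X + Y) i = X i + Y i := rfl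
@[simp] theorem W.zero_apply (i : Fin n) : (0 : W k n) i = 0 := rfl
@[simp] theorem W.smul_apply (c : k) (X : W k n) (i : Fin n) : (c • X) i = c • X i := rfl

@[ext] theorem W.ext {k : Type*} {n : ℕ} {X Y : W k n} (h : ∀ i, X i = Y i) : X = Y := funext h

theorem W.der_apply (X : W k n) (f : MvPowerSeries (Fin n) k) :
    X.der f = ∑ j, X j * MvPowerSeries.pderiv k j f := by
  simp only [W.der, ← Derivation.coeFnAddMonoidHom_apply, map_sum, Finset.sum_apply]
  exact Finset.sum_congr rfl fun j _ => rfl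

theorem W.der_add (X Y : W k n) (f : MvPowerSeries (Fin n) k) :
    (X + Y).der f = X.der f + Y.der f := by
  simp [W.der_apply, add_mul, Finset.sum_add_distrib]

theorem W.der_smul (c : k) (X : W k n) (f : MvPowerSeries (Fin n) k) :
    (c • X).der f = c • X.der f := by
  simp [W.der_apply, Finset.smul_sum]

theorem pderiv_comm (i j : Fin n) (f : MvPowerSeries (Fin n) k) :
    MvPowerSeries.pderiv k i (MvPowerSeries.pderiv k j f)
      = MvPowerSeries.pderiv k j (MvPowerSeries.pderiv k i f) := by
  ext d
  simp only [MvPowerSeries.coeff_pderiv]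
  by_cases h : i = j
  · subst h; rfl
  · have h' : j ≠ i := fun e => h e.symm
    rw [add_right_comm d]
    simp [h, h']
    ring

theorem W.der_bracket (X Y : W k n) (f : MvPowerSeries (Fin n) k) :
    ⁅X, Y⁆.der f = X.der (Y.der f) - Y.der (X.der f) := by
  have key : ∀ X Y : W k n, X.der (Y.der f) = (∑ i, X.der (Y i) * MvPowerSeries.pderiv k i f)
      + ∑ i, ∑ j, Y i * X j * MvPowerSeries.pderiv k j (MvPowerSeries.pderiv k i f) := by
    intro X Y
    rw [W.der_apply Y f, map_sum, ← Finset.sum_add_distrib]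
    refine Finset.sum_congr rfl fun i _ => ?_
    rw [Derivation.leibniz, smul_eq_mul, smul_eq_mul, add_comm, W.der_apply X
      (MvPowerSeries.pderiv k i f), Finset.mul_sum, mul_comm]
    congr 1
    exact Finset.sum_congr rfl fun j _ => by ring
  rw [key X Y, key Y X, W.der_apply]
  have sw : ∑ i, ∑ j, X i * Y j * MvPowerSeries.pderiv k j (MvPowerSeries.pderiv k i f)
      = ∑ i, ∑ j, Y i * X j * MvPowerSeries.pderiv k j (MvPowerSeries.pderiv k i f) := by
    rw [Finset.sum_comm]
    refine Finset.sum_congr rfl fun i _ => Finset.sum_congr rfl fun j _ => ?_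
    rw [pderiv_comm, mul_comm (X j)]
  rw [sw, add_sub_add_right_eq_sub, ← Finset.sum_sub_distrib]
  exact Finset.sum_congr rfl fun i _ => by rw [W.bracket_apply, sub_mul]

instance : LieRing (W k n) where
  add_lie X Y Z := by
    ext1 i; simp only [W.bracket_apply, W.add_apply, W.der_add, map_add]; abel
  lie_add X Y Z := by
    ext1 i; simp only [W.bracket_apply, W.add_apply, W.der_add, map_add]; abel
  lie_self X := by ext1 i; simp [W.bracket_apply]
  leibniz_lie X Y Z := by
    ext1 i
    simp only [W.bracket_apply, W.add_apply, W.der_bracket, map_sub]; abel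

instance : LieAlgebra k (W k n) where
  lie_smul c X Y := by
    ext1 i
    simp only [W.bracket_apply, W.smul_apply, W.der_smul, smul_sub, Derivation.map_smul]

/-- The vector field `e_i = ∂_i`. -/
def e (i : Fin n) : W k n := Pi.single (M := fun _ => MvPowerSeries (Fin n) k) i 1

/-- The vector field `e_i^j = x^j ∂_i`. -/
def ee (j i : Fin n) : W k n :=
  Pi.single (M := fun _ => MvPowerSeries (Fin n) k) i (MvPowerSeries.X j)

theorem W.coeff_der (X : W k n) (f : MvPowerSeries (Fin n) k) (K : Fin n →₀ ℕ)
    (h : ∀ j, ∀ A B : Fin n →₀ ℕ, A + B = K → MvPowerSeries.coeff A (X j) = 0 ∨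
      MvPowerSeries.coeff (B + Finsupp.single j 1) f = 0) :
    MvPowerSeries.coeff K (X.der f) = 0 := by
  classical
  rw [W.der_apply, map_sum]
  refine Finset.sum_eq_zero fun j _ => ?_
  rw [MvPowerSeries.coeff_mul]
  refine Finset.sum_eq_zero fun AB hAB => ?_
  rcases h j AB.1 AB.2 (Finset.HasAntidiagonal.mem_antidiagonal.mp hAB) with h | h
  · rw [h, zero_mul]
  · rw [MvPowerSeries.coeff_pderiv, h, zero_mul, mul_zero]

variable (k n)

/-- `𝔰`, the Lie algebra of affine vector fields: the span of all `e_i` and `e_i^j`, that is, the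
vector fields whose components have no terms of degree at least two. -/
def sAlg : LieSubalgebra k (W k n) where
  carrier := {X | ∀ i K, 2 ≤ K.degree → MvPowerSeries.coeff K (X i) = 0}
  add_mem' := by
    intro X Y hX hY i K hK
    simp [hX i K hK, hY i K hK]
  zero_mem' := by intro i K _; simp
  smul_mem' := by
    intro c X hX i K hK
    simp [hX i K hK]
  lie_mem' := by
    have key : ∀ X Y : W k n,
        (∀ i K, 2 ≤ Finsupp.degree K → MvPowerSeries.coeff K (X i) = 0) →
        (∀ i K, 2 ≤ Finsupp.degree K → MvPowerSeries.coeff K (Y i) = 0) →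
        ∀ i K, 2 ≤ Finsupp.degree K → MvPowerSeries.coeff K (X.der (Y i)) = 0 := by
      intro X Y hX hY i K hK
      refine W.coeff_der X _ K fun j A B hAB => ?_
      by_cases hA : 2 ≤ A.degree
      · exact Or.inl (hX j A hA)
      · refine Or.inr (hY i _ ?_)
        rw [← hAB, map_add] at hK
        rw [map_add, Finsupp.degree_single]
        omega
    intro X Y hX hY i K hK
    rw [W.bracket_apply, map_sub, key X Y hX hY i K hK, key Y X hY hX i K hK, sub_zero]

/-- `𝔫`, the Lie algebra of vector fields that vanish to second order at the origin: those whose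
components only have terms of degree at least two. -/
def nAlg : LieSubalgebra k (W k n) where
  carrier := {X | ∀ i K, K.degree < 2 → MvPowerSeries.coeff K (X i) = 0}
  add_mem' := by
    intro X Y hX hY i K hK
    simp [hX i K hK, hY i K hK]
  zero_mem' := by intro i K _; simp
  smul_mem' := by
    intro c X hX i K hK
    simp [hX i K hK]
  lie_mem' := by
    have key : ∀ X Y : W k n,
        (∀ i K, Finsupp.degree K < 2 → MvPowerSeries.coeff K (X i) = 0) →
        ∀ i K, Finsupp.degree K < 2 → MvPowerSeries.coeff K (X.der (Y i)) = 0 := by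
      intro X Y hX i K hK
      refine W.coeff_der X _ K fun j A B hAB => Or.inl (hX j A ?_)
      rw [← hAB, map_add] at hK
      omega
    intro X Y hX hY i K hK
    rw [W.bracket_apply, map_sub, key X Y hX i K hK, key Y X hY i K hK, sub_zero]

/-- The projection of `W_n = 𝔰 ⊕ 𝔫` onto `𝔰`, which truncates the components after degree one. -/
def prS : W k n →ₗ[k] sAlg k n where
  toFun X := ⟨fun i K => if K.degree < 2 then MvPowerSeries.coeff K (X i) else 0,
    fun i K hK => if_neg (not_lt.mpr hK)⟩
  map_add' X Y := by
    refine Subtype.ext (funext fun i => funext fun K => ?_)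
    change (if K.degree < 2 then _ else (0 : k)) = (if K.degree < 2 then _ else 0) + (if K.degree < 2 then _ else 0)
    split_ifs <;> simp
  map_smul' c X := by
    refine Subtype.ext (funext fun i => funext fun K => ?_)
    change (if K.degree < 2 then _ else (0 : k)) = c * (if K.degree < 2 then _ else 0)
    split_ifs <;> simp

/-- The projection of `W_n = 𝔰 ⊕ 𝔫` onto `𝔫`, which removes the terms of degree at most one. -/
def prN : W k n →ₗ[k] nAlg k n where
  toFun X := ⟨fun i K => if 2 ≤ K.degree then MvPowerSeries.coeff K (X i) else 0,
    fun i K hK => if_neg (not_le.mpr hK)⟩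
  map_add' X Y := by
    refine Subtype.ext (funext fun i => funext fun K => ?_)
    change (if 2 ≤ K.degree then _ else (0 : k)) = (if 2 ≤ K.degree then _ else 0) + (if 2 ≤ K.degree then _ else 0)
    split_ifs <;> simp
  map_smul' c X := by
    refine Subtype.ext (funext fun i => funext fun K => ?_)
    change (if 2 ≤ K.degree then _ else (0 : k)) = c * (if 2 ≤ K.degree then _ else 0)
    split_ifs <;> simp

/-- `e_i^j = x^j ∂_i` as an element of `𝔰`. -/
def eeS (j i : Fin n) : sAlg k n := ⟨ee j i, by
  classical
  intro l K hK
  by_cases hl : l = i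
  · subst hl
    rw [ee, Pi.single_eq_same, MvPowerSeries.coeff_X, if_neg]
    rintro rfl
    simp at hK
  · rw [ee, Pi.single_eq_of_ne hl, map_zero]⟩

/-- The element `θ^l` of `𝔰^*` that is dual to `e_l` with respect to the basis `e_i, e_i^j`:
it reads off the value at the origin of the `l`-th component. -/
def theta (l : Fin n) : Module.Dual k (sAlg k n) where
  toFun X := MvPowerSeries.coeff 0 (X.1 l)
  map_add' X Y := by simp
  map_smul' c X := by simp

end FormalVectorFields

/-! ### Formal differential forms of degree at most one -/

section FormalForms

/-- The space `Ω_n^{≤1} ⊗̂ V` of formal differential forms of degree at most one in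
`x_1, …, x_n` with coefficients in `V`. The value of `ω` at `none` and the multi-index `K` is the
coefficient of `x^K` in the `0`-form part, and its value at `some j` and `K` is the coefficient of
`x^K dx^j`. -/
abbrev Forms (n : ℕ) (V : Type*) : Type _ := Option (Fin n) → (Fin n →₀ ℕ) → V

variable {k : Type*} [Field k] {n : ℕ}
variable {V V' V'' : Type*} [AddCommGroup V] [Module k V] [AddCommGroup V'] [Module k V']
  [AddCommGroup V''] [Module k V'']

/-- The product of forms of degree at most one, `(a + α)(b + β) = ab + aβ + αb` for `0`-forms
`a, b` and `1`-forms `α, β`, with coefficients multiplied by a bilinear map `B`. -/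
def Forms.mul (B : V →ₗ[k] V' →ₗ[k] V'') (x : Forms n V) (y : Forms n V') : Forms n V''
  | none, L => ∑ KM ∈ Finset.HasAntidiagonal.antidiagonal L, B (x none KM.1) (y none KM.2)
  | some j, L => ∑ KM ∈ Finset.HasAntidiagonal.antidiagonal L,
      (B (x none KM.1) (y (some j) KM.2) + B (x (some j) KM.1) (y none KM.2))

variable (k n) in
/-- The product on `Ω_n^{≤1}` itself, as a bilinear map. -/
def formsMul : Forms n k →ₗ[k] Forms n k →ₗ[k] Forms n k :=
  LinearMap.mk₂ k (Forms.mul (LinearMap.mul k k))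
    (by
      intro x y z; funext o L
      cases o <;> simp only [Forms.mul, map_add, LinearMap.add_apply, Pi.add_apply,
        Finset.sum_add_distrib]
      abel)
    (by
      intro c x z; funext o L
      cases o <;> simp [Forms.mul, Finset.mul_sum, mul_assoc, mul_add])
    (by
      intro x y z; funext o L
      cases o <;> simp only [Forms.mul, map_add, Pi.add_apply, Finset.sum_add_distrib]
      abel)
    (by
      intro c x z; funext o L
      cases o <;> simp [Forms.mul, Finset.mul_sum, mul_left_comm, mul_add])

variable {A : Type*} [CommRing A] [Algebra k A]

/-- The pullback along the formal map `x ↦ χ(x)` of the form `x^K` (for `none`) or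
`x^K dx^j` (for `some j`). It is `χ^K`, respectively `∑ l, χ^K (∂_l χ^j) dx^l`. -/
def pullbackMonomial (χ : Fin n → MvPowerSeries (Fin n) A) (K : Fin n →₀ ℕ) :
    Option (Fin n) → Forms n A
  | none => fun
    | none => fun L => MvPowerSeries.coeff L (∏ i, χ i ^ K i)
    | some _ => 0
  | some j => fun
    | none => 0
    | some l => fun L => MvPowerSeries.coeff L ((∏ i, χ i ^ K i) * MvPowerSeries.pderiv A l (χ j))

/-- The pullback of formal forms along a formal map `χ` that fixes the origin; this is the
continuous extension of `pullbackMonomial`, tensored with the identity of `V`. As `χ` has no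
constant term, the terms with `L.degree < K.degree` do not contribute to the coefficient at `L`,
and are left out of the sum. -/
def Forms.pullback (χ : Fin n → MvPowerSeries (Fin n) A) (x : Forms n V) : Forms n (A ⊗[k] V) :=
  fun o L => ∑ o', ∑ d ∈ Finset.range (L.degree + 1), ∑ K ∈ Finset.univ.finsuppAntidiag d,
    pullbackMonomial χ K o' o L ⊗ₜ[k] x o' K

end FormalForms

/-! ### The Hopf algebra of regular functions on the group `N` -/

section HopfAlgebraOfFunctions

variable (k : Type*) [Field k] (n : ℕ)

/-- The multi-indices of the partial derivatives of order at least two. -/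
abbrev Idx : Type := {K : Fin n →₀ ℕ // 2 ≤ K.degree}

/-- The algebra `F(N)` of regular functions on the group `N` of diffeomorphisms `ψ` with
`ψ(0) = 0` and `ψ'(0) = Id`: polynomials in the coordinate functions
`α^i_K(ψ) = ∂^K ψ^i (0)`, `|K| ≥ 2`. -/
abbrev FN : Type _ := MvPolynomial (Fin n × Idx n) k

variable {n}

/-- `K! = ∏ K_i!`, as a scalar. -/
def multiFactorial (K : Fin n →₀ ℕ) : k := ∏ i, ((K i).factorial : k)

variable {k}
variable {A : Type*} [CommRing A] [Algebra k A]

/-- The formal diffeomorphism `ψ` over `A`, tangent to the identity, whose coordinates are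
`α^i_K(ψ) = φ (α^i_K)`. For `φ = id` this is the universal such diffeomorphism. -/
def diffeo (φ : FN k n →ₐ[k] A) (i : Fin n) : MvPowerSeries (Fin n) A := fun K =>
  if h : 2 ≤ K.degree then (multiFactorial k K)⁻¹ • φ (MvPolynomial.X (i, ⟨K, h⟩))
  else if K = Finsupp.single i 1 then 1 else 0

/-- Evaluation of regular functions at the formal diffeomorphism `ψ` over `A`. -/
def evalAt (ψ : Fin n → MvPowerSeries (Fin n) A) : FN k n →ₐ[k] A :=
  MvPolynomial.aeval fun v => multiFactorial k v.2.1 • MvPowerSeries.coeff v.2.1 (ψ v.1)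

variable (k n)

/-- The comultiplication, `Δ(f)(φ, ψ) = f(φ ∘ ψ)`. -/
def comul : FN k n →ₐ[k] FN k n ⊗[k] FN k n :=
  evalAt fun i => MvPowerSeries.subst (diffeo Algebra.TensorProduct.includeRight)
    (diffeo (Algebra.TensorProduct.includeLeft : FN k n →ₐ[k] FN k n ⊗[k] FN k n) i)

/-- The counit, `ε(f) = f(id)`. -/
def counit : FN k n →ₐ[k] k := evalAt MvPowerSeries.X

/-- The inverse of the universal diffeomorphism `ψ` up to terms of degree `m + 2`, by the iteration
`χ ↦ x - (ψ - x) ∘ χ`, which starts at `χ = x`. -/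
def approxInv (m : ℕ) : Fin n → MvPowerSeries (Fin n) (FN k n) :=
  (fun χ i => MvPowerSeries.X i
    - MvPowerSeries.subst χ (diffeo (AlgHom.id k (FN k n)) i - MvPowerSeries.X i))^[m]
    MvPowerSeries.X

/-- The antipode, `S(f)(ψ) = f(ψ⁻¹)`. The terms of `ψ⁻¹` of degree `|K|` are those of
`approxInv |K|`. -/
def antipode : FN k n →ₐ[k] FN k n :=
  MvPolynomial.aeval fun v => multiFactorial k v.2.1 •
    MvPowerSeries.coeff v.2.1 (approxInv k n v.2.1.degree v.1)

/-- The `q`-fold comultiplication `h ↦ h_(1) ⊗ ⋯ ⊗ h_(q)`, which is the counit for `q = 0`: the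
convolution product of the `q` inclusions of `F(N)` into its `q`-th tensor power. -/
def iterComul (q : ℕ) : FN k n →ₐ[k] ⨂[k]^q (FN k n) :=
  (List.ofFn fun j : Fin q =>
      PiTensorProduct.singleAlgHom (R := k) (A := fun _ : Fin q => FN k n) j).foldr
    (fun φ ψ => (Algebra.TensorProduct.lift φ ψ fun _ _ => Commute.all _ _).comp (comul k n))
    ((Algebra.ofId k _).comp (counit k n))

/-- The action `h · (g^1 ⊗ ⋯ ⊗ g^q) = h_(1) g^1 ⊗ ⋯ ⊗ h_(q) g^q`. -/
def diagAct (q : ℕ) : FN k n →ₗ[k] ⨂[k]^q (FN k n) →ₗ[k] ⨂[k]^q (FN k n) :=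
  PiTensorProduct.mul ∘ₗ (iterComul k n q).toLinearMap

variable {k n} in
/-- The derivative at the origin of a polynomial along the vector `c`: the `ε`-part of `f(ε c)`
over the dual numbers. -/
def derivAtZero {σ : Type*} (c : σ → k) : MvPolynomial σ k →ₗ[k] k :=
  TrivSqZeroExt.sndHom k k ∘ₗ
    (MvPolynomial.aeval fun v => c v • (DualNumber.eps : DualNumber k)).toLinearMap

variable {k n} in
theorem derivAtZero_C {σ : Type*} (c : σ → k) (a : k) :
    derivAtZero c (MvPolynomial.C a) = 0 := by
  simp [derivAtZero, TrivSqZeroExt.algebraMap_eq_inl]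

variable {k n} in
theorem derivAtZero_mul_X {σ : Type*} (c : σ → k) (p : MvPolynomial σ k) (v : σ) :
    derivAtZero c (p * MvPolynomial.X v) = MvPolynomial.constantCoeff p * c v := by
  have h : (MvPolynomial.aeval (fun v => c v • (DualNumber.eps : DualNumber k)) p).fst
      = MvPolynomial.constantCoeff p := by
    induction p using MvPolynomial.induction_on with
    | C a => simp [TrivSqZeroExt.algebraMap_eq_inl]
    | add p q hp hq => simp [hp, hq]
    | mul_X p v hp => simp
  simp only [derivAtZero, LinearMap.comp_apply, AlgHom.toLinearMap_apply, map_mul,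
    TrivSqZeroExt.sndHom_apply, TrivSqZeroExt.snd_mul, h]
  simp

variable {k n} in
theorem derivAtZero_add {σ : Type*} (c d : σ → k) :
    derivAtZero (c + d) = derivAtZero c + derivAtZero d := by
  refine LinearMap.ext fun f => ?_
  induction f using MvPolynomial.induction_on with
  | C a => simp [derivAtZero_C]
  | add p q hp hq => rw [map_add, map_add, hp, hq]
  | mul_X p v hp => simp [derivAtZero_mul_X, mul_add]

variable {k n} in
theorem derivAtZero_smul {σ : Type*} (r : k) (c : σ → k) :
    derivAtZero (r • c) = r • derivAtZero c := by
  refine LinearMap.ext fun f => ?_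
  induction f using MvPolynomial.induction_on with
  | C a => simp [derivAtZero_C]
  | add p q hp hq => rw [map_add, map_add, hp, hq]
  | mul_X p v hp => simp [derivAtZero_mul_X, mul_left_comm]

/-- The pairing `⟨ξ, f⟩` of `ξ ∈ 𝔫` with `f ∈ F(N)`: the derivative of `f` at the identity of `N`
along `exp(-tξ)`, which is the `ε`-part of `f(x - ε ξ(x))`. There the coordinate `α^i_K` takes the
value `-(∂^K ξ^i)(0) ε`. With this sign, the pairing dualizes the right coactions of `F(N)` used
below to the left actions of `𝔫` by Lie derivative on forms and by the bracket on
`W_n / 𝔫 ≅ 𝔰`. -/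
def pairing : nAlg k n →ₗ[k] Module.Dual k (FN k n) where
  toFun ξ := derivAtZero fun v => -(multiFactorial k v.2.1 * MvPowerSeries.coeff v.2.1 (ξ.1 v.1))
  map_add' ξ ζ := by
    rw [← derivAtZero_add]
    congr 1
    funext v
    simp [mul_add, add_comm]
  map_smul' r ξ := by
    rw [RingHom.id_apply, ← derivAtZero_smul]
    congr 1
    funext v
    simp [mul_left_comm]

end HopfAlgebraOfFunctions

/-! ### Coactions -/

section Coactions

variable (k : Type*) [Field k] (n : ℕ)

/-- The right coaction `ω ↦ ω_⟨0⟩ ⊗ ω_⟨1⟩` of `F(N)` on forms (the factor `ω_⟨1⟩` is written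
first), `ω_⟨0⟩ ω_⟨1⟩(ψ) = (ψ⁻¹)^* ω`. -/
def formCoact {V : Type*} [AddCommGroup V] [Module k V] : Forms n V → Forms n (FN k n ⊗[k] V) :=
  Forms.pullback (diffeo (antipode k n))

/-- The regular function `η^i_{jl}(ψ) = ((ψ'(x)⁻¹)^i_ν ∂_j ∂_l ψ^ν(x))|_{x = 0} = ∂_j ∂_l ψ^i(0)`. -/
def etaFn {n : ℕ} (i j l : Fin n) : FN k n :=
  MvPolynomial.X (i, ⟨(Finsupp.single j 1 + Finsupp.single l 1 : Fin n →₀ ℕ), by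
    simp [Finsupp.degree_single]⟩)

/-- The left coaction `θ ↦ θ_⟨-1⟩ ⊗ θ_⟨0⟩` of `F(N)` on `𝔰^*`. It is `θ^i ↦ 1 ⊗ θ^i` and
`θ^i_j ↦ 1 ⊗ θ^i_j + ∑ l, η^i_{jl} ⊗ θ^l` on the basis dual to `e_i, e_i^j`. -/
def dualCoact : Module.Dual k (sAlg k n) →ₗ[k] FN k n ⊗[k] Module.Dual k (sAlg k n) :=
  TensorProduct.mk k (FN k n) (Module.Dual k (sAlg k n)) 1 +
    ∑ i : Fin n, ∑ j : Fin n, ∑ l : Fin n,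
    LinearMap.toSpanSingleton k (FN k n ⊗[k] Module.Dual k (sAlg k n))
      (etaFn k i j l ⊗ₜ[k] theta k n l) ∘ₗ Module.Dual.eval k (sAlg k n) (eeS k n j i)

theorem lTensor_ι_swap {k R M : Type*} [Field k] [CommRing R] [Algebra k R] [AddCommGroup M]
    [Module k M] (t u : R ⊗[k] M) :
    (ExteriorAlgebra.ι k).lTensor R t * (ExteriorAlgebra.ι k).lTensor R u
      + (ExteriorAlgebra.ι k).lTensor R u * (ExteriorAlgebra.ι k).lTensor R t
      = (0 : R ⊗[k] ExteriorAlgebra k M) := by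
  induction t with
  | zero => simp
  | add t t' ht ht' =>
    rw [map_add, add_mul, mul_add, add_add_add_comm, ht, ht', add_zero]
  | tmul r m =>
    induction u with
    | zero => simp
    | add u u' hu hu' =>
      rw [map_add, add_mul, mul_add, add_add_add_comm, hu, hu', add_zero]
    | tmul s m' =>
      simp only [LinearMap.lTensor_tmul, Algebra.TensorProduct.tmul_mul_tmul]
      rw [mul_comm s r, ← TensorProduct.tmul_add, ExteriorAlgebra.ι_add_mul_swap,
        TensorProduct.tmul_zero]

theorem lTensor_ι_sq {k R M : Type*} [Field k] [CommRing R] [Algebra k R] [AddCommGroup M]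
    [Module k M] (t : R ⊗[k] M) :
    (ExteriorAlgebra.ι k).lTensor R t * (ExteriorAlgebra.ι k).lTensor R t
      = (0 : R ⊗[k] ExteriorAlgebra k M) := by
  induction t with
  | zero => simp
  | tmul r m =>
    simp only [LinearMap.lTensor_tmul, Algebra.TensorProduct.tmul_mul_tmul]
    rw [ExteriorAlgebra.ι_sq_zero, TensorProduct.tmul_zero]
  | add t u ht hu =>
    rw [map_add, add_mul, mul_add, mul_add, ht, hu, zero_add, add_zero, lTensor_ι_swap]

/-- The multiplicative extension of `dualCoact` to the exterior algebra of `𝔰^*`. -/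
def extCoact : ExteriorAlgebra k (Module.Dual k (sAlg k n)) →ₐ[k]
    FN k n ⊗[k] ExteriorAlgebra k (Module.Dual k (sAlg k n)) :=
  ExteriorAlgebra.lift k
    ⟨(ExteriorAlgebra.ι k).lTensor (FN k n) ∘ₗ dualCoact k n, fun _ => lTensor_ι_sq _⟩

/-- `∧^p 𝔰^*`. -/
abbrev ExtS (p : ℕ) : Type _ := ⋀[k]^p (Module.Dual k (sAlg k n))

/-- The left coaction `η ↦ η_⟨-1⟩ ⊗ η_⟨0⟩` of `F(N)` on `∧^p 𝔰^*`. As `extCoact` preserves degrees,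
it is the part of degree `p` of `extCoact` on elements of degree `p`. -/
def wedgeCoact (p : ℕ) : ExtS k n p →ₗ[k] FN k n ⊗[k] ExtS k n p :=
  (DirectSum.component k ℕ (fun i => ExtS k n i) p ∘ₗ
      (DirectSum.decomposeLinearEquiv
        fun i => ⋀[k]^i (Module.Dual k (sAlg k n))).toLinearMap).lTensor (FN k n) ∘ₗ
    (extCoact k n).toLinearMap ∘ₗ (⋀[k]^p (Module.Dual k (sAlg k n))).subtype

/-- The exterior product `∧^p 𝔰^* × ∧^p' 𝔰^* → ∧^(p+p') 𝔰^*`. -/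
def wedge (p p' : ℕ) : ExtS k n p →ₗ[k] ExtS k n p' →ₗ[k] ExtS k n (p + p') :=
  DirectSum.gMulLHom k (fun i => ExtS k n i)

end Coactions

/-! ### Two constructions of multilinear algebra -/

section MultilinearAlgebra

variable {k : Type*} [Field k]

/-- `c ↦ (x ⊗ y ↦ (x' ⊗ y' ↦ w(x, x') ⊗ c(y, y')))`. -/
def mapRight₂ {X X' X'' Y Y' Y'' : Type*} [AddCommGroup X] [Module k X] [AddCommGroup X']
    [Module k X'] [AddCommGroup X''] [Module k X''] [AddCommGroup Y] [Module k Y]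
    [AddCommGroup Y'] [Module k Y'] [AddCommGroup Y''] [Module k Y''] (w : X →ₗ[k] X' →ₗ[k] X'') :
    (Y →ₗ[k] Y' →ₗ[k] Y'') →ₗ[k] X ⊗[k] Y →ₗ[k] X' ⊗[k] Y' →ₗ[k] X'' ⊗[k] Y'' where
  toFun c := TensorProduct.map₂ w c
  map_add' c c' := by ext; simp [TensorProduct.tmul_add]
  map_smul' r c := by ext; simp

/-- An alternating map `Φ` of arguments `(X, ξ)` as an alternating map of `X` with values in the
alternating maps of `ξ`, restricted along linear maps `f` and `g`. -/
def curryAlt {M N S T ι κ : Type*} [AddCommGroup M] [Module k M] [AddCommGroup N] [Module k N]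
    [AddCommGroup S] [Module k S] [AddCommGroup T] [Module k T] (Φ : M [⋀^ι ⊕ κ]→ₗ[k] N)
    (f : S →ₗ[k] M) (g : T →ₗ[k] M) : S [⋀^ι]→ₗ[k] (T [⋀^κ]→ₗ[k] N) where
  toFun X :=
    { (Φ.toMultilinearMap.currySum fun i => f (X i)).compLinearMap fun _ => g with
      toFun := fun ξ => Φ (Sum.elim (fun i => f (X i)) fun j => g (ξ j))
      map_eq_zero_of_eq' := fun ξ i j hij hne =>
        Φ.map_eq_zero_of_eq _ (i := Sum.inr i) (j := Sum.inr j) (by simp [hij])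
          (by simpa using hne) }
  map_update_add' X i x y := by
    refine AlternatingMap.ext fun ξ => ?_
    exact congrArg (fun m => m fun j => g (ξ j))
      ((Φ.toMultilinearMap.currySum.compLinearMap fun _ => f).map_update_add X i x y)
  map_update_smul' X i c x := by
    refine AlternatingMap.ext fun ξ => ?_
    exact congrArg (fun m => m fun j => g (ξ j))
      ((Φ.toMultilinearMap.currySum.compLinearMap fun _ => f).map_update_smul X i c x)
  map_eq_zero_of_eq' X i j hij hne := by
    refine AlternatingMap.ext fun ξ => ?_
    exact Φ.map_eq_zero_of_eq _ (i := Sum.inl i) (j := Sum.inl j) (by simp [hij])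
      (by simpa using hne)

end MultilinearAlgebra

/-! ### The product on the Hopf-cyclic bicomplex -/

section HopfBicomplex

variable (k : Type*) [Field k] (n : ℕ)

/-- `∧^p 𝔰^* ⊗ F(N)^{⊗q}`. -/
abbrev HopfCoeff (p q : ℕ) : Type _ := ExtS k n p ⊗[k] ⨂[k]^q (FN k n)

/-- `C^{p,q}(Ω_{nδ}^{≤1}, 𝔰^*, F(N)) = Ω_n^{≤1} ⊗ ∧^p 𝔰^* ⊗ F(N)^{⊗q}`, with the completed tensor
product over the formal power series. -/
abbrev HopfC (p q : ℕ) : Type _ := Forms n (HopfCoeff k n p q)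

/-- `h ⊗ f ↦ (g ↦ f ⊗ h · g)`, for `h ∈ F(N)`, `f ∈ F(N)^{⊗q}`, `g ∈ F(N)^{⊗q'}`. -/
def concatAct (q q' : ℕ) : FN k n →ₗ[k] ⨂[k]^q (FN k n) →ₗ[k]
    ⨂[k]^q' (FN k n) →ₗ[k] ⨂[k]^(q + q') (FN k n) where
  toFun h := (TensorProduct.curry
    (TensorPower.mulEquiv (R := k) (M := FN k n) (n := q) (m := q')).toLinearMap).compl₂
      (diagAct k n q' h)
  map_add' h h' := by rw [map_add]; ext; simp [TensorProduct.tmul_add]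
  map_smul' c h := by rw [map_smul]; ext; simp

/-- `h ↦ (η ⊗ f ↦ (ζ ⊗ g ↦ η ∧ ζ ⊗ f ⊗ h · g))`. -/
def prodAct (p q p' q' : ℕ) : FN k n →ₗ[k] HopfCoeff k n p q →ₗ[k] HopfCoeff k n p' q' →ₗ[k]
    HopfCoeff k n (p + p') (q + q') :=
  mapRight₂ (wedge k n p p') ∘ₗ concatAct k n q q'

/-- `h ⊗ η ⊗ f ↦ S(h) η_⟨-1⟩ ⊗ η_⟨0⟩ ⊗ f`. -/
def twist (p q : ℕ) : FN k n ⊗[k] HopfCoeff k n p q →ₗ[k] FN k n ⊗[k] HopfCoeff k n p q :=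
  (LinearMap.mul' k (FN k n)).rTensor (HopfCoeff k n p q) ∘ₗ
    (TensorProduct.assoc k (FN k n) (FN k n) (HopfCoeff k n p q)).symm.toLinearMap ∘ₗ
    TensorProduct.map (antipode k n).toLinearMap
      ((TensorProduct.assoc k (FN k n) (ExtS k n p) (⨂[k]^q (FN k n))).toLinearMap ∘ₗ
        (wedgeCoact k n p).rTensor (⨂[k]^q (FN k n)))

variable {k n}

/-- `(a ⊗ η ⊗ f) ∪ (ω ⊗ ζ ⊗ g) = a_⟨0⟩ ω ⊗ η_⟨0⟩ ∧ ζ ⊗ f ⊗ S(a_⟨1⟩) η_⟨-1⟩ · g`. -/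
def HopfC.cup {p q p' q' : ℕ} (x : HopfC k n p q) (y : HopfC k n p' q') :
    HopfC k n (p + p') (q + q') :=
  Forms.mul (TensorProduct.lift (prodAct k n p q p' q') ∘ₗ twist k n p q) (formCoact k n x) y

/-- The product `x * y = (-1)^{q p'} x ∪ y`, for `x` of bidegree `(p, q)` and `y` of bidegree
`(p', q')`. -/
def HopfC.star {p q p' q' : ℕ} (x : HopfC k n p q) (y : HopfC k n p' q') :
    HopfC k n (p + p') (q + q') :=
  (-1 : k) ^ (q * p') • x.cup y

/-- Normalized cochains: all coefficients are linear combinations of `ζ ⊗ g^1 ⊗ ⋯ ⊗ g^q` where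
each `g^j` vanishes under the counit. -/
def HopfC.IsNormalized {p q : ℕ} (y : HopfC k n p q) : Prop :=
  ∀ o K, y o K ∈ Submodule.span k {t : HopfCoeff k n p q | ∃ (ζ : ExtS k n p) (g : Fin q → FN k n),
    (∀ j, counit k n (g j) = 0) ∧ t = ζ ⊗ₜ[k] PiTensorProduct.tprod k g}

end HopfBicomplex

/-! ### The Lie algebra bicomplex and its cup product -/

section LieBicomplex

variable (k : Type*) [Field k] (n : ℕ)

/-- The cochains `C^m(W_n, Ω_n^{≤1}) = Hom(∧^m W_n, Ω_n^{≤1})`. -/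
abbrev LieC (m : ℕ) : Type _ := W k n [⋀^Fin m]→ₗ[k] Forms n k

/-- The cochains of bidegree `(p, q)` in `(X_1, …, X_p | ξ_1, …, ξ_q)`, `X_i ∈ 𝔰` and `ξ_j ∈ 𝔫`,
with values in `Ω_n^{≤1}`. -/
abbrev BiC (p q : ℕ) : Type _ := sAlg k n [⋀^Fin p]→ₗ[k] (nAlg k n [⋀^Fin q]→ₗ[k] Forms n k)

/-- The total complex in degree `m`: a cochain of each bidegree `(p, q)` with `p + q = m`. -/
abbrev TotC (m : ℕ) : Type _ :=
  (r : {r : ℕ × ℕ // r ∈ Finset.HasAntidiagonal.antidiagonal m}) → BiC k n r.1.1 r.1.2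

variable {k n}

/-- The cup product of Lie algebra cochains: the sum over shuffles
`∑ ± c(ξ_{s_1}, …, ξ_{s_p}) c'(ξ_{t_1}, …, ξ_{t_q})`. -/
def LieC.cup {p q : ℕ} (c : LieC k n p) (c' : LieC k n q) : LieC k n (p + q) :=
  ((TensorProduct.lift (formsMul k n)).compAlternatingMap (c.domCoprod c')).domDomCongr
    finSumFinEquiv

/-- The component of bidegree `(p, q)` of `♮(Φ)`:
`♮(Φ)(X_1, …, X_p | ξ_1, …, ξ_q) = Φ(X_1, …, X_p, ξ_1, …, ξ_q)`. -/
def naturalComp {m : ℕ} (Φ : LieC k n m) (p q : ℕ) (h : p + q = m) : BiC k n p q :=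
  curryAlt (Φ.domDomCongr (finSumFinEquiv.trans (finCongr h)).symm)
    (sAlg k n).toSubmodule.subtype (nAlg k n).toSubmodule.subtype

/-- The map `♮` from the cochains of `W_n = 𝔰 ⋈ 𝔫` to the total complex. -/
def natural {m : ℕ} (Φ : LieC k n m) : TotC k n m := fun r =>
  naturalComp Φ r.1.1 r.1.2 (Finset.HasAntidiagonal.mem_antidiagonal.mp r.2)

/-- The inverse of `♮` on cochains of bidegree `(p, q)`,
`♮⁻¹(Φ)(X_1 ⊕ ξ_1, …) = ∑_{σ ∈ Sh(p, q)} (-1)^σ Φ(X_{σ(1)}, …, X_{σ(p)} | ξ_{σ(p+1)}, …)`. The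
shuffle sum of `(X_{σ(1)} ∧ ⋯ ∧ X_{σ(p)}) ⊗ (ξ_{σ(p+1)} ∧ ⋯ ∧ ξ_{σ(p+q)})` is formed first, and the
linear map on `∧^p 𝔰 ⊗ ∧^q 𝔫` given by `Φ` is applied to it. -/
def naturalInv {p q : ℕ} (Φ : BiC k n p q) : LieC k n (p + q) :=
  ((TensorProduct.lift (exteriorPower.alternatingMapLinearEquiv.toLinearMap ∘ₗ
      exteriorPower.alternatingMapLinearEquiv Φ)).compAlternatingMap
    (((exteriorPower.ιMulti k p).compLinearMap (prS k n)).domCoprod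
      ((exteriorPower.ιMulti k q).compLinearMap (prN k n)))).domDomCongr finSumFinEquiv

/-- The cup product on the total complex, `Φ ∪ Φ' = ♮(♮⁻¹(Φ) ∪ ♮⁻¹(Φ'))`. -/
def BiC.cup {p q p' q' : ℕ} (Φ : BiC k n p q) (Φ' : BiC k n p' q') :
    TotC k n ((p + q) + (p' + q')) :=
  natural (LieC.cup (naturalInv Φ) (naturalInv Φ'))

/-- A cochain of bidegree `(p, q)` as an element of the total complex. -/
def BiC.toTot {p q : ℕ} (Φ : BiC k n p q) {m : ℕ} (h : p + q = m) : TotC k n m :=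
  Pi.single (M := fun r : {r : ℕ × ℕ // r ∈ Finset.HasAntidiagonal.antidiagonal m} =>
    BiC k n r.1.1 r.1.2) ⟨(p, q), Finset.HasAntidiagonal.mem_antidiagonal.mpr h⟩ Φ

end LieBicomplex

/-! ### The van Est type map -/

section VanEstMap

variable (k : Type*) [Field k] (n : ℕ)

/-- `(X_1, …, X_p) ↦ (η ↦ η(X_1, …, X_p))`. -/
def evalS (p : ℕ) : sAlg k n [⋀^Fin p]→ₗ[k] Module.Dual k (ExtS k n p) :=
  (exteriorPower.pairingDual k (sAlg k n) p).flip.compAlternatingMap (exteriorPower.ιMulti k p)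

/-- `(ξ_1, …, ξ_q) ↦ (f^1 ⊗ ⋯ ⊗ f^q ↦ ∑_{σ ∈ S_q} (-1)^σ ⟨ξ_{σ(1)}, f^1⟩ ⋯ ⟨ξ_{σ(q)}, f^q⟩)`. -/
def evalN (q : ℕ) : nAlg k n [⋀^Fin q]→ₗ[k] Module.Dual k (⨂[k]^q (FN k n)) :=
  MultilinearMap.alternatization
    ((PiTensorProduct.dualDistrib (R := k) (M := fun _ : Fin q => FN k n)).compMultilinearMap
      ((PiTensorProduct.tprod k).compLinearMap fun _ => pairing k n))

variable {k n}

/-- The map `𝒱`,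
`𝒱(ω ⊗ η ⊗ f^1 ⊗ ⋯ ⊗ f^q)(X_1, …, X_p | ξ_1, …, ξ_q)
  = η(X_1, …, X_p) ∑_{σ ∈ S_q} (-1)^σ ⟨ξ_{σ(1)}, f^1⟩ ⋯ ⟨ξ_{σ(q)}, f^q⟩ ω`. -/
def vanEst {p q : ℕ} (x : HopfC k n p q) : BiC k n p q :=
  LinearMap.compAlternatingMap
    { toFun := fun φ => LinearMap.compAlternatingMap
        { toFun := fun χ o K => TensorProduct.dualDistrib k _ _ (φ ⊗ₜ[k] χ) (x o K)
          map_add' := fun χ χ' => by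
            funext o K
            rw [TensorProduct.tmul_add, map_add]; rfl
          map_smul' := fun c χ => by
            funext o K
            rw [TensorProduct.tmul_smul, map_smul]; rfl }
        (evalN k n q)
      map_add' := fun φ φ' => by
        ext ξ o K
        simp [TensorProduct.add_tmul]
      map_smul' := fun c φ => by
        ext ξ o K
        change TensorProduct.dualDistrib k _ _ ((c • φ) ⊗ₜ[k] _) (x o K)
          = c • TensorProduct.dualDistrib k _ _ (φ ⊗ₜ[k] _) (x o K)
        rw [← TensorProduct.smul_tmul', map_smul]; rfl }
    (evalS k n p)

end VanEstMap

end VanEst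

end

noncomputable section

namespace VanEst

/-! ### The counit, the antipode and the comultiplication -/

section Counit

variable {k : Type*} [Field k] {n : ℕ}

/-! Each function on `N` enters `𝒱` through its derivative at the identity, and such a derivative
satisfies `⟨ξ, hg⟩ = ε(h)⟨ξ, g⟩ + ⟨ξ, h⟩ε(g)`. When `ε(g) = 0` only the first term survives
(`pairing_mul`). Hence the diagonal action of `h` on normalized tensors is seen by `𝒱` only through
the product of the counits of the legs of the iterated comultiplication of `h`, which is `ε(h)`
(`counitPow_iterComul`, `evalN_mulEquiv_diagAct`). For `h = S(a_⟨1⟩) η_⟨-1⟩` this scalar is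
`ε(a_⟨1⟩) ε(η_⟨-1⟩)`, and the counit laws of the two coactions (`evalOne_formCoact`,
`evalOne_wedgeCoact`) restore `a` and `η`. So `𝒱` does not distinguish the twisted product from the
plain one `η ∧ ζ ⊗ f ⊗ g` (`vanEst_cup`). Of the Hopf structure, only the behaviour at the identity
of `N` enters. It remains to compare the plain product with the cup product on `W_n`. Each form
coefficient of `♮⁻¹ ∘ 𝒱` on a decomposable tensor is an exterior product of linear forms on `W_n`,
namely `θ_i` after the projection to `𝔰` and `⟨·, f_j⟩` after the projection to `𝔫`
(`coch_ιMulti_tprod`, `formCoeff_naturalInv_vanEst`). The cup product lists these forms in the order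
`θ, f, θ', g`, the plain product in the order `θ, θ', f, g`. Exchanging the blocks of lengths `q`
and `p'` costs `(-1)^{qp'}`, exactly the sign in `*` (`sign_middleSwap`, `coch_plainMul`). Finally,
`♮(♮⁻¹ Φ)` is `Φ` placed in its own bidegree (`natural_naturalInv`), which turns this equality of
cochains on `W_n` into one in the total complex. -/

theorem counit_X (v : Fin n × Idx n) : counit k n (MvPolynomial.X v) = 0 := by
  obtain ⟨i, K, hK⟩ := v
  have hne : K ≠ Finsupp.single i 1 := by
    rintro rfl
    simp at hK
  simp only [counit, evalAt, MvPolynomial.aeval_X]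
  rw [MvPowerSeries.coeff_X, if_neg hne, smul_zero]

theorem counit_eq_constantCoeff (f : FN k n) :
    counit k n f = MvPolynomial.constantCoeff f := by
  induction f using MvPolynomial.induction_on with
  | C a => rw [← MvPolynomial.algebraMap_eq, AlgHom.commutes]; simp [MvPolynomial.algebraMap_eq]
  | add p q hp hq => rw [map_add, map_add, hp, hq]
  | mul_X p v hp => rw [map_mul, counit_X]; simp

/-- All coordinates `α^i_K` vanish at the identity. Pushing coefficients forward along `counit`
therefore replaces the universal diffeomorphism by `x`, which is how every counit law below is
proved. -/
theorem diffeo_counit : diffeo (counit k n) = MvPowerSeries.X := by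
  classical
  funext i
  ext K
  change (if h : 2 ≤ K.degree then (multiFactorial k K)⁻¹ • counit k n (MvPolynomial.X (i, ⟨K, h⟩))
    else if K = Finsupp.single i 1 then (1 : k) else 0) = _
  rw [MvPowerSeries.coeff_X]
  split_ifs with h h' h'
  · subst h'
    simp at h
  · rw [counit_X, smul_zero]
  · rfl
  · rfl

variable {A B : Type*} [CommRing A] [Algebra k A] [CommRing B] [Algebra k B]

theorem map_diffeo (f : A →ₐ[k] B) (φ : FN k n →ₐ[k] A) (i : Fin n) :
    MvPowerSeries.map (f : A →+* B) (diffeo φ i) = diffeo (f.comp φ) i := by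
  ext K
  rw [MvPowerSeries.coeff_map]
  change f (if h : 2 ≤ K.degree then (multiFactorial k K)⁻¹ • φ (MvPolynomial.X (i, ⟨K, h⟩))
    else if K = Finsupp.single i 1 then 1 else 0) =
    (if h : 2 ≤ K.degree then (multiFactorial k K)⁻¹ • f (φ (MvPolynomial.X (i, ⟨K, h⟩)))
    else if K = Finsupp.single i 1 then 1 else 0)
  split_ifs <;> simp

theorem constantCoeff_diffeo (φ : FN k n →ₐ[k] A) (i : Fin n) :
    MvPowerSeries.constantCoeff (diffeo φ i) = 0 := by
  change (if h : 2 ≤ (0 : Fin n →₀ ℕ).degree then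
    (multiFactorial k (0 : Fin n →₀ ℕ))⁻¹ • φ (MvPolynomial.X (i, ⟨0, h⟩))
    else if (0 : Fin n →₀ ℕ) = Finsupp.single i 1 then (1 : A) else 0) = 0
  rw [dif_neg (by simp), if_neg]
  intro h
  simpa using DFunLike.congr_fun h i

theorem comp_evalAt (f : A →ₐ[k] B) (ψ : Fin n → MvPowerSeries (Fin n) A) :
    f.comp (evalAt ψ) = evalAt fun i => MvPowerSeries.map (f : A →+* B) (ψ i) := by
  refine MvPolynomial.algHom_ext fun v => ?_
  simp [evalAt]

/-- Such an `f` evaluates a function of `(φ, ψ)` at `φ = ψ = id`, where `φ ∘ ψ = id`. -/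
theorem lift_comp_comul (f : FN k n ⊗[k] FN k n →ₐ[k] k)
    (hl : f.comp Algebra.TensorProduct.includeLeft = counit k n)
    (hr : f.comp Algebra.TensorProduct.includeRight = counit k n) :
    f.comp (comul k n) = counit k n := by
  rw [comul, comp_evalAt, counit]
  congr 1
  funext i
  rw [MvPowerSeries.map_subst
    (MvPowerSeries.hasSubst_of_constantCoeff_zero fun s => constantCoeff_diffeo _ s)]
  simp only [map_diffeo, hl, hr, diffeo_counit]
  exact congrFun MvPowerSeries.subst_self _

theorem constantCoeff_approxInv (m : ℕ) (i : Fin n) :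
    MvPowerSeries.constantCoeff (approxInv k n m i) = 0 := by
  induction m generalizing i with
  | zero => simp [approxInv]
  | succ m ih =>
    rw [approxInv, Function.iterate_succ_apply', map_sub, MvPowerSeries.constantCoeff_X, zero_sub,
      neg_eq_zero]
    refine MvPowerSeries.constantCoeff_subst_eq_zero
      (MvPowerSeries.hasSubst_of_constantCoeff_zero ih) ih ?_
    rw [map_sub, constantCoeff_diffeo, MvPowerSeries.constantCoeff_X, sub_zero]

/-- At `ψ = x` the correction `(ψ - x) ∘ χ` is zero, so the iteration never leaves its starting
point `x`. -/
theorem map_counit_approxInv (m : ℕ) (i : Fin n) :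
    MvPowerSeries.map (counit k n : FN k n →+* k) (approxInv k n m i) = MvPowerSeries.X i := by
  cases m with
  | zero => simp [approxInv]
  | succ m =>
    rw [approxInv, Function.iterate_succ_apply', ← approxInv, map_sub, MvPowerSeries.map_X,
      MvPowerSeries.map_subst
        (MvPowerSeries.hasSubst_of_constantCoeff_zero (constantCoeff_approxInv m)),
      map_sub, map_diffeo, MvPowerSeries.map_X, AlgHom.comp_id, diffeo_counit, sub_self]
    rw [← MvPowerSeries.coe_substAlgHom (MvPowerSeries.HasSubst.map
        (MvPowerSeries.hasSubst_of_constantCoeff_zero (constantCoeff_approxInv m)) _), map_zero,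
      sub_zero]

theorem counit_comp_antipode : (counit k n).comp (antipode k n) = counit k n := by
  refine MvPolynomial.algHom_ext fun v => ?_
  rw [AlgHom.comp_apply, antipode, MvPolynomial.aeval_X, map_smul]
  have := congrArg (MvPowerSeries.coeff v.2.1) (map_counit_approxInv (k := k) v.2.1.degree v.1)
  rw [MvPowerSeries.coeff_map] at this
  rw [RingHom.coe_coe] at this
  rw [this, counit, evalAt, MvPolynomial.aeval_X]

theorem counit_antipode (h : FN k n) : counit k n (antipode k n h) = counit k n h :=
  DFunLike.congr_fun counit_comp_antipode h

/-- Stated for an arbitrary list of maps so that the fold in `iterComul` can be handled by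
induction: a convolution product of maps that become `ε` under the character `e` becomes `ε` as
well. The empty list gives `ε` itself. -/
theorem comp_foldr_comul (e : A →ₐ[k] k) (l : List (FN k n →ₐ[k] A))
    (hl : ∀ φ ∈ l, e.comp φ = counit k n) :
    e.comp (l.foldr
      (fun φ ψ => (Algebra.TensorProduct.lift φ ψ fun _ _ => Commute.all _ _).comp (comul k n))
      ((Algebra.ofId k A).comp (counit k n))) = counit k n := by
  induction l with
  | nil => exact AlgHom.ext fun h => by simp [Algebra.ofId_apply]
  | cons φ l ih =>
    rw [List.foldr_cons, ← AlgHom.comp_assoc]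
    refine lift_comp_comul _ ?_ ?_
    · rw [AlgHom.comp_assoc, ← hl φ (by simp)]
      congr 1
      ext; simp
    · refine Eq.trans ?_ (ih fun φ hφ => hl φ (by simp [hφ]))
      rw [AlgHom.comp_assoc]
      congr 1
      exact AlgHom.ext fun h => by simp

variable (k n) in
/-- The counit of `F(N)^{⊗q}`. -/
def counitPow (q : ℕ) : (⨂[k]^q (FN k n)) →ₐ[k] k :=
  PiTensorProduct.liftAlgHom
    ((MultilinearMap.mkPiAlgebra k (Fin q) k).compLinearMap fun _ => (counit k n).toLinearMap)
    (by simp) (by simp [Finset.prod_mul_distrib])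

theorem counitPow_tprod {q : ℕ} (f : Fin q → FN k n) :
    counitPow k n q (PiTensorProduct.tprod k f) = ∏ j, counit k n (f j) := by
  simp [counitPow, PiTensorProduct.liftAlgHom]

/-- Each of the `q` inclusions into the tensor power fills the other slots with `1`, so `counitPow`
restricts to `ε` along it. -/
theorem counitPow_iterComul (q : ℕ) (h : FN k n) :
    counitPow k n q (iterComul k n q h) = counit k n h := by
  refine DFunLike.congr_fun (comp_foldr_comul (counitPow k n q) _ fun φ hφ => ?_) h
  obtain ⟨j, rfl⟩ := (List.mem_ofFn' _ _).mp hφ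
  refine AlgHom.ext fun f => ?_
  rw [AlgHom.comp_apply, PiTensorProduct.singleAlgHom_apply, counitPow_tprod,
    Finset.prod_eq_single j]
  · simp
  · intro i _ hi
    simp [Pi.mulSingle_eq_of_ne hi]
  · simp

end Counit

/-! ### The action of `F(N)` on normalized elements -/

section Pairing

variable {k : Type*} [Field k] {n : ℕ}

theorem derivAtZero_mul {σ : Type*} (c : σ → k) (p q : MvPolynomial σ k) :
    derivAtZero c (p * q) = MvPolynomial.constantCoeff p * derivAtZero c q
      + derivAtZero c p * MvPolynomial.constantCoeff q := by
  have h (p : MvPolynomial σ k) :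
      (MvPolynomial.aeval (fun v => c v • (DualNumber.eps : DualNumber k)) p).fst
      = MvPolynomial.constantCoeff p := by
    induction p using MvPolynomial.induction_on with
    | C a => simp [TrivSqZeroExt.algebraMap_eq_inl]
    | add p q hp hq => simp [hp, hq]
    | mul_X p v hp => simp
  simp only [derivAtZero, LinearMap.comp_apply, AlgHom.toLinearMap_apply, map_mul,
    TrivSqZeroExt.sndHom_apply, TrivSqZeroExt.snd_mul, h]
  simp [mul_comm]

/-- The pairing is a derivation over `ε`; the term `⟨ξ, h⟩ε(g)` is the one that normalization
removes. -/
theorem pairing_mul (ξ : nAlg k n) (h g : FN k n) (hg : counit k n g = 0) :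
    pairing k n ξ (h * g) = counit k n h * pairing k n ξ g := by
  rw [counit_eq_constantCoeff] at hg ⊢
  refine (derivAtZero_mul _ _ _).trans ?_
  rw [hg, mul_zero, add_zero]
  rfl

theorem mulEquiv_tprod_tprod {q q' : ℕ} (f : Fin q → FN k n) (g : Fin q' → FN k n) :
    TensorPower.mulEquiv (R := k) (PiTensorProduct.tprod k f ⊗ₜ[k] PiTensorProduct.tprod k g)
      = PiTensorProduct.tprod k (Fin.append f g) :=
  TensorPower.tprod_mul_tprod k f g

theorem evalN_tprod {q : ℕ} (ξ : Fin q → nAlg k n) (f : Fin q → FN k n) :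
    evalN k n q ξ (PiTensorProduct.tprod k f)
      = ∑ σ : Equiv.Perm (Fin q), Equiv.Perm.sign σ • ∏ j, pairing k n (ξ (σ j)) (f j) := by
  simp [evalN, MultilinearMap.alternatization_apply, LinearMap.sum_apply]

/-- Under `evalN`, the diagonal action on normalized elements is multiplication by the counit. -/
theorem evalN_mulEquiv_diagAct {q q' : ℕ} (ξ : Fin (q + q') → nAlg k n) (h : FN k n)
    (f : ⨂[k]^q (FN k n)) (g : Fin q' → FN k n) (hg : ∀ j, counit k n (g j) = 0) :
    evalN k n (q + q') ξ (TensorPower.mulEquiv (R := k)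
        (f ⊗ₜ[k] diagAct k n q' h (PiTensorProduct.tprod k g)))
      = counit k n h * evalN k n (q + q') ξ (TensorPower.mulEquiv (R := k)
        (f ⊗ₜ[k] PiTensorProduct.tprod k g)) := by
  rw [← counitPow_iterComul q', diagAct, LinearMap.comp_apply, AlgHom.toLinearMap_apply]
  -- The identity holds for every `t` in the tensor power, with `counitPow` as the scalar. Both
  -- sides are linear in `t` and `f`, so pure tensors suffice.
  generalize iterComul k n q' h = t
  induction f using PiTensorProduct.induction_on with
  | add f f' hf hf' => simp only [TensorProduct.add_tmul, map_add, hf, hf', mul_add]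
  | smul_tprod r f =>
    induction t using PiTensorProduct.induction_on with
    | add t t' ht ht' =>
      simp only [TensorProduct.tmul_add, map_add, LinearMap.add_apply, ht, ht', add_mul]
    | smul_tprod s t =>
      simp only [map_smul, LinearMap.smul_apply, TensorProduct.tmul_smul,
        ← TensorProduct.smul_tmul', PiTensorProduct.mul_tprod_tprod, mulEquiv_tprod_tprod,
        smul_eq_mul, counitPow_tprod, evalN_tprod]
      have key (σ : Equiv.Perm (Fin (q + q'))) :
          ∏ j, pairing k n (ξ (σ j)) (Fin.append f (t * g) j)
            = (∏ j, counit k n (t j)) * ∏ j, pairing k n (ξ (σ j)) (Fin.append f g j) := by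
        simp only [Fin.prod_univ_add, Fin.append_left, Fin.append_right, Pi.mul_apply,
          pairing_mul _ _ _ (hg _), Finset.prod_mul_distrib]
        ring
      simp only [key, Finset.mul_sum, mul_smul_comm]
      refine Finset.sum_congr rfl fun σ _ => ?_
      ring_nf

end Pairing

/-! ### Evaluation of coactions at the unit of `N` -/

section EvalOne

variable {k : Type*} [Field k] {n : ℕ}
variable {V V' : Type*} [AddCommMonoid V] [Module k V] [AddCommMonoid V'] [Module k V']

variable (k n V) in
/-- `h ⊗ v ↦ ε(h) v`. -/
def evalOne : FN k n ⊗[k] V →ₗ[k] V :=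
  (TensorProduct.lid k V).toLinearMap ∘ₗ (counit k n).toLinearMap.rTensor V

@[simp] theorem evalOne_tmul (h : FN k n) (v : V) : evalOne k n V (h ⊗ₜ v) = counit k n h • v := by
  simp [evalOne]

theorem evalOne_lTensor (f : V →ₗ[k] V') (t : FN k n ⊗[k] V) :
    evalOne k n V' (f.lTensor (FN k n) t) = f (evalOne k n V t) := by
  induction t with
  | zero => simp
  | tmul h v => simp
  | add t t' ht ht' => simp only [map_add, ht, ht']

theorem evalOne_dualCoact (θ : Module.Dual k (sAlg k n)) :
    evalOne k n _ (dualCoact k n θ) = θ := by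
  simp [dualCoact, LinearMap.sum_apply, etaFn, counit_X]

/-- Evaluation at the identity is multiplicative, so its composite with `extCoact` is an algebra
endomorphism of the exterior algebra and is determined on `𝔰^*`. There the terms `η^i_{jl}` vanish
under the counit. -/
theorem evalOne_extCoact (η : ExteriorAlgebra k (Module.Dual k (sAlg k n))) :
    evalOne k n _ (extCoact k n η) = η := by
  let E : FN k n ⊗[k] ExteriorAlgebra k (Module.Dual k (sAlg k n)) →ₐ[k]
      ExteriorAlgebra k (Module.Dual k (sAlg k n)) :=
    (Algebra.TensorProduct.lid k _).toAlgHom.comp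
      (Algebra.TensorProduct.map (counit k n) (AlgHom.id k _))
  have hE : E.toLinearMap = evalOne k n _ := by
    ext h v
    simp [E]
  have : E.comp (extCoact k n) = AlgHom.id k _ := by
    refine ExteriorAlgebra.hom_ext (LinearMap.ext fun θ => ?_)
    simp only [LinearMap.comp_apply, AlgHom.toLinearMap_apply, AlgHom.comp_apply, extCoact,
      ExteriorAlgebra.lift_ι_apply, AlgHom.id_apply]
    rw [← AlgHom.toLinearMap_apply E, hE, evalOne_lTensor, evalOne_dualCoact]
  rw [← hE]
  exact DFunLike.congr_fun this η

theorem evalOne_wedgeCoact {p : ℕ} (η : ExtS k n p) :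
    evalOne k n _ (wedgeCoact k n p η) = η := by
  rw [wedgeCoact, LinearMap.comp_apply, LinearMap.comp_apply, evalOne_lTensor,
    AlgHom.toLinearMap_apply, evalOne_extCoact, LinearMap.comp_apply, Submodule.subtype_apply]
  simp

/-- The counit is multiplicative and invariant under the antipode, so `ε(S(h) η_⟨-1⟩) = ε(h)
ε(η_⟨-1⟩)`, and `ε(η_⟨-1⟩) η_⟨0⟩ = η`. -/
theorem evalOne_twist {p q : ℕ} (t : FN k n ⊗[k] HopfCoeff k n p q) :
    evalOne k n _ (twist k n p q t) = evalOne k n _ t := by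
  induction t with
  | zero => simp
  | add t t' ht ht' => simp only [map_add, ht, ht']
  | tmul h c =>
    induction c using TensorProduct.induction_on with
    | zero => simp
    | add c c' hc hc' => simp only [TensorProduct.tmul_add, map_add, hc, hc']
    | tmul η f =>
      -- The coaction `wedgeCoact k n p η` is not a pure tensor; it is replaced by an arbitrary `u`,
      -- in which both sides are linear.
      have key (u : FN k n ⊗[k] ExtS k n p) :
          evalOne k n _ ((LinearMap.mul' k (FN k n)).rTensor (HopfCoeff k n p q)
            ((TensorProduct.assoc k (FN k n) (FN k n) (HopfCoeff k n p q)).symm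
              (antipode k n h ⊗ₜ[k]
                TensorProduct.assoc k (FN k n) (ExtS k n p) (⨂[k]^q (FN k n)) (u ⊗ₜ f))))
            = counit k n h • (evalOne k n _ u ⊗ₜ[k] f) := by
        induction u with
        | zero => simp
        | add u u' hu hu' =>
          simp only [TensorProduct.tmul_add, TensorProduct.add_tmul, map_add, hu, hu', smul_add]
        | tmul g η => simp [counit_antipode, mul_smul, TensorProduct.smul_tmul']
      simpa [twist, evalOne_wedgeCoact] using key (wedgeCoact k n p η)

variable {A B : Type*} [CommRing A] [Algebra k A] [CommRing B] [Algebra k B]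

theorem map_pullbackMonomial (f : A →ₐ[k] B) (χ : Fin n → MvPowerSeries (Fin n) A)
    (K : Fin n →₀ ℕ) (o' o : Option (Fin n)) (L : Fin n →₀ ℕ) :
    f (pullbackMonomial χ K o' o L)
      = pullbackMonomial (fun i => MvPowerSeries.map (f : A →+* B) (χ i)) K o' o L := by
  have hp (l j : Fin n) : MvPowerSeries.map (f : A →+* B) (MvPowerSeries.pderiv A l (χ j))
      = MvPowerSeries.pderiv B l (MvPowerSeries.map (f : A →+* B) (χ j)) := by
    ext d
    simp [MvPowerSeries.coeff_pderiv]
  have hc (g : MvPowerSeries (Fin n) A) : f (MvPowerSeries.coeff L g)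
      = MvPowerSeries.coeff L (MvPowerSeries.map (f : A →+* B) g) := by
    rw [MvPowerSeries.coeff_map]; rfl
  cases o' <;> cases o <;> simp only [pullbackMonomial, Pi.zero_apply, map_zero] <;>
    rw [hc] <;> simp [map_prod, hp]

theorem pullbackMonomial_X (K : Fin n →₀ ℕ) (o' o : Option (Fin n)) (L : Fin n →₀ ℕ) :
    pullbackMonomial (MvPowerSeries.X : Fin n → MvPowerSeries (Fin n) k) K o' o L
      = if o' = o ∧ K = L then 1 else 0 := by
  classical
  have hm : ∏ i, (MvPowerSeries.X i : MvPowerSeries (Fin n) k) ^ K i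
      = MvPowerSeries.monomial K 1 := by
    have := MvPowerSeries.monomial_one_eq (R := k) K
    rw [this, Finsupp.prod_fintype]
    simp
  have hp (l j : Fin n) : MvPowerSeries.pderiv k l (MvPowerSeries.X j : MvPowerSeries (Fin n) k)
      = if j = l then 1 else 0 := by
    ext d
    rw [MvPowerSeries.coeff_pderiv, MvPowerSeries.coeff_X]
    split_ifs with h1 h2 h2
    · subst h2
      have : d = 0 := by simpa using h1
      simp [this]
    · have := DFunLike.congr_fun h1 l
      simp [h2] at this
    · subst h2
      have : d ≠ 0 := by simpa using h1
      simp [MvPowerSeries.coeff_one, this]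
    · simp
  cases o' <;> cases o <;> simp only [pullbackMonomial, Pi.zero_apply, hm, hp]
  · simp [MvPowerSeries.coeff_monomial, eq_comm]
  · simp
  · simp
  · rename_i j l
    by_cases h : j = l
    · simp [h, MvPowerSeries.coeff_monomial, eq_comm]
    · simp [h]

/-- At the identity the inverse diffeomorphism is `x`, and pullback along `x` has the Kronecker
delta as its matrix of coefficients. -/
theorem evalOne_formCoact {V : Type*} [AddCommGroup V] [Module k V] (x : Forms n V)
    (o : Option (Fin n)) (L : Fin n →₀ ℕ) :
    evalOne k n V (formCoact k n x o L) = x o L := by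
  classical
  have hX : (fun i => MvPowerSeries.map (counit k n : FN k n →+* k) (diffeo (antipode k n) i))
      = MvPowerSeries.X := by
    funext i
    rw [map_diffeo, counit_comp_antipode, diffeo_counit]
  simp only [formCoact, Forms.pullback, map_sum, evalOne_tmul, map_pullbackMonomial, hX,
    pullbackMonomial_X]
  -- The surviving term `K = L` has degree `L.degree`, the last value allowed by the truncation
  -- `range (L.degree + 1)`.
  rw [Finset.sum_eq_single o, Finset.sum_eq_single L.degree, Finset.sum_eq_single L]
  · simp
  · intro K _ hK
    simp [hK]
  · intro h
    exact absurd (by simp [Finset.mem_finsuppAntidiag, Finsupp.degree_eq_sum]) h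
  · intro d _ hd
    refine Finset.sum_eq_zero fun K hK => ?_
    have : K ≠ L := by
      rintro rfl
      apply hd
      rw [Finset.mem_finsuppAntidiag] at hK
      rw [← hK.1, Finsupp.degree_eq_sum]
    simp [this]
  · simp
  · intro o' _ ho'
    simp [ho']
  · simp

end EvalOne

/-! ### The van Est map only sees the untwisted product -/

section Untwist

variable {k : Type*} [Field k] {n : ℕ}

variable (k n) in
/-- The untwisted product `(η ⊗ f, ζ ⊗ g) ↦ η ∧ ζ ⊗ f ⊗ g`. -/
def plainMul (p q p' q' : ℕ) : HopfCoeff k n p q →ₗ[k] HopfCoeff k n p' q' →ₗ[k]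
    HopfCoeff k n (p + p') (q + q') :=
  mapRight₂ (wedge k n p p') (TensorProduct.curry
    (TensorPower.mulEquiv (R := k) (M := FN k n) (n := q) (m := q')).toLinearMap)

theorem plainMul_tmul {p q p' q' : ℕ} (η : ExtS k n p) (f : ⨂[k]^q (FN k n))
    (ζ : ExtS k n p') (g : ⨂[k]^q' (FN k n)) :
    plainMul k n p q p' q' (η ⊗ₜ f) (ζ ⊗ₜ g)
      = wedge k n p p' η ζ ⊗ₜ TensorPower.mulEquiv (R := k) (f ⊗ₜ[k] g) := rfl

theorem prodAct_tmul {p q p' q' : ℕ} (h : FN k n) (η : ExtS k n p) (f : ⨂[k]^q (FN k n))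
    (ζ : ExtS k n p') (g : ⨂[k]^q' (FN k n)) :
    prodAct k n p q p' q' h (η ⊗ₜ f) (ζ ⊗ₜ g)
      = wedge k n p p' η ζ ⊗ₜ TensorPower.mulEquiv (R := k) (f ⊗ₜ[k] diagAct k n q' h g) := rfl

theorem lift_apply_of_counit {V V' V'' : Type*} [AddCommMonoid V] [Module k V]
    [AddCommMonoid V'] [Module k V'] [AddCommMonoid V''] [Module k V'']
    (P : FN k n →ₗ[k] V →ₗ[k] V' →ₗ[k] V'') (Q : V →ₗ[k] V' →ₗ[k] V'') (φ : Module.Dual k V'')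
    (c : V') (h : ∀ f b, φ (P f b c) = counit k n f * φ (Q b c)) (u : FN k n ⊗[k] V) :
    φ (TensorProduct.lift P u c) = φ (Q (evalOne k n V u) c) := by
  induction u with
  | zero => simp
  | add u u' hu hu' => simp only [map_add, LinearMap.add_apply, hu, hu']
  | tmul f b => simp [h]

theorem apply_eq_mul_of_tmul {M N V' V'' : Type*} [AddCommMonoid M] [Module k M]
    [AddCommMonoid N] [Module k N] [AddCommMonoid V'] [Module k V'] [AddCommMonoid V'']
    [Module k V''] (P Q : M ⊗[k] N →ₗ[k] V' →ₗ[k] V'') (φ : Module.Dual k V'') (r : k) (c : V')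
    (h : ∀ m l, φ (P (m ⊗ₜ l) c) = r * φ (Q (m ⊗ₜ l) c)) (b : M ⊗[k] N) :
    φ (P b c) = r * φ (Q b c) := by
  induction b with
  | zero => simp
  | add b b' hb hb' => simp only [map_add, LinearMap.add_apply, mul_add, hb, hb']
  | tmul m l => exact h m l

/-- Linearity in `c` reduces to the spanning tensors in the definition of normalization, and
linearity in `b` to `η ⊗ f`; there only the factor in `F(N)^{⊗(q+q')}` depends on `h`. -/
theorem dualDistrib_prodAct {p q p' q' : ℕ} (X : Fin (p + p') → sAlg k n)
    (ξ : Fin (q + q') → nAlg k n) {c : HopfCoeff k n p' q'}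
    (hc : c ∈ Submodule.span k {t : HopfCoeff k n p' q' | ∃ (ζ : ExtS k n p') (g : Fin q' → FN k n),
      (∀ j, counit k n (g j) = 0) ∧ t = ζ ⊗ₜ[k] PiTensorProduct.tprod k g})
    (h : FN k n) (b : HopfCoeff k n p q) :
    TensorProduct.dualDistrib k _ _ (evalS k n (p + p') X ⊗ₜ[k] evalN k n (q + q') ξ)
        (prodAct k n p q p' q' h b c)
      = counit k n h * TensorProduct.dualDistrib k _ _
        (evalS k n (p + p') X ⊗ₜ[k] evalN k n (q + q') ξ) (plainMul k n p q p' q' b c) := by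
  refine LinearMap.eqOn_span (f := TensorProduct.dualDistrib k _ _
      (evalS k n (p + p') X ⊗ₜ[k] evalN k n (q + q') ξ) ∘ₗ prodAct k n p q p' q' h b)
    (g := counit k n h • (TensorProduct.dualDistrib k _ _
      (evalS k n (p + p') X ⊗ₜ[k] evalN k n (q + q') ξ) ∘ₗ plainMul k n p q p' q' b)) ?_ hc
  rintro _ ⟨ζ, g, hg, rfl⟩
  change TensorProduct.dualDistrib k _ _ (evalS k n (p + p') X ⊗ₜ[k] evalN k n (q + q') ξ)
        (prodAct k n p q p' q' h b (ζ ⊗ₜ[k] PiTensorProduct.tprod k g))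
      = counit k n h * TensorProduct.dualDistrib k _ _
        (evalS k n (p + p') X ⊗ₜ[k] evalN k n (q + q') ξ)
        (plainMul k n p q p' q' b (ζ ⊗ₜ[k] PiTensorProduct.tprod k g))
  refine apply_eq_mul_of_tmul _ _ _ _ _ (fun η f => ?_) b
  rw [prodAct_tmul, plainMul_tmul, TensorProduct.dualDistrib_apply,
    TensorProduct.dualDistrib_apply, evalN_mulEquiv_diagAct _ _ _ _ hg, mul_left_comm]

/-- A coefficient of a product of forms is a finite sum of products of coefficients, so functionals
can be compared factor by factor. The left factors may have different coefficient spaces: `x₁` will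
be the coacted form with values in `F(N) ⊗ V₂`, and `x₂` the original one. -/
theorem map_formsMul_congr {V₁ V₂ V' V'' : Type*} [AddCommGroup V₁] [Module k V₁]
    [AddCommGroup V₂] [Module k V₂] [AddCommGroup V'] [Module k V'] [AddCommGroup V'']
    [Module k V''] (φ : Module.Dual k V'') (B₁ : V₁ →ₗ[k] V' →ₗ[k] V'')
    (B₂ : V₂ →ₗ[k] V' →ₗ[k] V'') (x₁ : Forms n V₁) (x₂ : Forms n V₂) (y : Forms n V')
    (h : ∀ o o' K M, φ (B₁ (x₁ o K) (y o' M)) = φ (B₂ (x₂ o K) (y o' M)))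
    (o : Option (Fin n)) (L : Fin n →₀ ℕ) :
    φ (Forms.mul B₁ x₁ y o L) = φ (Forms.mul B₂ x₂ y o L) := by
  cases o <;> simp only [Forms.mul, map_sum, map_add, h]

theorem vanEst_cup {p q p' q' : ℕ} (x : HopfC k n p q) (y : HopfC k n p' q')
    (hy : y.IsNormalized) :
    vanEst (x.cup y) = vanEst (Forms.mul (plainMul k n p q p' q') x y) := by
  refine AlternatingMap.ext fun X => AlternatingMap.ext fun ξ => funext fun o => funext fun L => ?_
  refine map_formsMul_congr (V₁ := FN k n ⊗[k] HopfCoeff k n p q) (V₂ := HopfCoeff k n p q)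
    (V' := HopfCoeff k n p' q') (V'' := HopfCoeff k n (p + p') (q + q')) (TensorProduct.dualDistrib k _ _
      (evalS k n (p + p') X ⊗ₜ[k] evalN k n (q + q') ξ))
    (TensorProduct.lift (prodAct k n p q p' q') ∘ₗ twist k n p q) (plainMul k n p q p' q')
    (formCoact k n x) x y (fun o o' K M => ?_) o L
  refine (lift_apply_of_counit (prodAct k n p q p' q') (plainMul k n p q p' q') _ _
      (dualDistrib_prodAct X ξ (hy o' M)) _).trans ?_
  rw [evalOne_twist]
  exact congrArg (fun b => TensorProduct.dualDistrib k _ _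
      (evalS k n (p + p') X ⊗ₜ[k] evalN k n (q + q') ξ) (plainMul k n p q p' q' b (y o' M)))
      (evalOne_formCoact x o K)

end Untwist

/-! ### The sign of a block transposition -/

section BlockSign

theorem finRotate_pow_apply (m b : ℕ) (i : Fin (m + 1)) :
    ((finRotate (m + 1) ^ b) i : ℕ) = (i + b) % (m + 1) := by
  induction b with
  | zero => simp [Nat.mod_eq_of_lt i.2]
  | succ b ih =>
    rw [pow_succ', Equiv.Perm.mul_apply, finRotate_apply, Fin.val_add, ih]
    simp [Fin.coe_ofNat_eq_mod, ← Nat.add_assoc]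

/-- The permutation of `Fin (a + b)` that moves the first `a` elements behind the last `b`. -/
def blockSwap (a b : ℕ) : Equiv.Perm (Fin (a + b)) :=
  finAddFlip.trans (finCongr (Nat.add_comm b a))

theorem blockSwap_castAdd (a b : ℕ) (i : Fin a) :
    (blockSwap a b (Fin.castAdd b i) : ℕ) = b + i := by
  simp [blockSwap, add_comm]

theorem blockSwap_natAdd (a b : ℕ) (i : Fin b) :
    (blockSwap a b (Fin.natAdd a i) : ℕ) = i := by
  simp [blockSwap]

/-- Moving a block of length `a` past one of length `b` is the `b`-th power of the cyclic rotation,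
of sign `(-1)^{(a+b-1)b}`. This equals `(-1)^{ab}` because `b(b-1)` is even. -/
theorem sign_blockSwap (a b : ℕ) : Equiv.Perm.sign (blockSwap a b) = (-1) ^ (a * b) := by
  rcases Nat.eq_zero_or_pos (a + b) with h | h
  · have ha : a = 0 := by omega
    have hb : b = 0 := by omega
    subst ha hb
    rw [show blockSwap 0 0 = 1 from Equiv.ext fun i => i.elim0]
    simp
  · obtain ⟨m, hm⟩ : ∃ m, a + b = m + 1 := ⟨a + b - 1, by omega⟩
    have : blockSwap a b = finRotate (a + b) ^ b := by
      -- Generalizing `a + b` to a variable lets `a + b = m + 1` be substituted inside the type `Fin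
      -- (a + b)`.
      have key (m : ℕ) (hm : a + b = m + 1) (i : Fin (a + b)) :
          ((finRotate (a + b) ^ b) i : ℕ) = (i + b) % (a + b) := by
        generalize a + b = N at hm i
        subst hm
        exact finRotate_pow_apply m b i
      refine Equiv.ext fun i => Fin.ext ?_
      rw [key m hm]
      induction i using Fin.addCases with
      | left i =>
        rw [blockSwap_castAdd, Fin.val_castAdd, Nat.mod_eq_of_lt (by omega), add_comm]
      | right i =>
        rw [blockSwap_natAdd, Fin.val_natAdd, add_right_comm, Nat.add_mod_left,
          Nat.mod_eq_of_lt (by omega)]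
    rw [this, map_pow, sign_finRotate, ← pow_mul]
    rcases b with _ | b
    · simp
    · have : (a + (b + 1) - 1) * (b + 1) = a * (b + 1) + b * (b + 1) := by
        rw [Nat.add_succ_sub_one, add_mul]
      rw [this, pow_add, (Nat.even_mul_succ_self b).neg_one_pow, mul_one]

/-- The permutation of `Fin (p + q + (p' + q'))` that exchanges the blocks of lengths `q`
and `p'`. -/
def middleSwap (p q p' q' : ℕ) : Equiv.Perm (Fin (p + q + (p' + q'))) :=
  ((finSumFinEquiv.sumCongr finSumFinEquiv).trans finSumFinEquiv).symm.trans
    ((Equiv.sumSumSumComm (Fin p) (Fin q) (Fin p') (Fin q')).trans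
      ((finSumFinEquiv.sumCongr finSumFinEquiv).trans
        (finSumFinEquiv.trans (finCongr (Nat.add_add_add_comm p p' q q')))))

theorem middleSwap_apply (p q p' q' : ℕ) (y : (Fin p ⊕ Fin q) ⊕ (Fin p' ⊕ Fin q')) :
    middleSwap p q p' q' (finSumFinEquiv (Sum.map finSumFinEquiv finSumFinEquiv y))
      = finSumFinEquiv.trans (finCongr (Nat.add_add_add_comm p p' q q'))
        (Sum.map finSumFinEquiv finSumFinEquiv (Equiv.sumSumSumComm _ _ _ _ y)) := by
  change middleSwap p q p' q' (((finSumFinEquiv.sumCongr finSumFinEquiv).trans finSumFinEquiv) y)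
    = _
  rw [middleSwap, Equiv.trans_apply, Equiv.symm_apply_apply]
  rfl

/-- The regrouping `E` into an outer block, a middle block of length `q + p'` and another outer
block conjugates the permutation to `1 ⊕ blockSwap q p' ⊕ 1`. -/
theorem sign_middleSwap (p q p' q' : ℕ) :
    Equiv.Perm.sign (middleSwap p q p' q') = (-1) ^ (q * p') := by
  let E : Fin p ⊕ (Fin (q + p') ⊕ Fin q') ≃ Fin (p + q + (p' + q')) :=
    ((Equiv.refl _).sumCongr finSumFinEquiv).trans
      (finSumFinEquiv.trans (finCongr (by omega)))
  have hE : middleSwap p q p' q' = E.permCongr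
      (Equiv.sumCongr (1 : Equiv.Perm (Fin p))
        (Equiv.sumCongr (blockSwap q p') (1 : Equiv.Perm (Fin q')))) := by
    -- For an index `y` in one of the four blocks, `z` is its position in the regrouping and `z'`
    -- the position after the swap. This leaves only equalities of natural numbers to check.
    have key (z z') (y) (h1 : E z = ((finSumFinEquiv.sumCongr finSumFinEquiv).trans
        finSumFinEquiv) y)
        (h2 : Equiv.sumCongr (1 : Equiv.Perm (Fin p))
        (Equiv.sumCongr (blockSwap q p') (1 : Equiv.Perm (Fin q'))) z = z')
        (h3 : (finCongr (Nat.add_add_add_comm p p' q q')) (finSumFinEquiv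
          ((finSumFinEquiv.sumCongr finSumFinEquiv) (Equiv.sumSumSumComm _ _ _ _ y))) = E z') :
        middleSwap p q p' q' (((finSumFinEquiv.sumCongr finSumFinEquiv).trans
        finSumFinEquiv) y) = E.permCongr
      (Equiv.sumCongr (1 : Equiv.Perm (Fin p))
        (Equiv.sumCongr (blockSwap q p') (1 : Equiv.Perm (Fin q'))))
          (((finSumFinEquiv.sumCongr finSumFinEquiv).trans finSumFinEquiv) y) := by
      rw [Equiv.permCongr_apply, ← h1, Equiv.symm_apply_apply, h2, ← h3, h1, middleSwap,
        Equiv.trans_apply, Equiv.symm_apply_apply]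
      rfl
    refine Equiv.ext fun i => ?_
    obtain ⟨y, rfl⟩ := ((finSumFinEquiv.sumCongr finSumFinEquiv).trans finSumFinEquiv).surjective i
    rcases y with (y | y) | (y | y)
    · refine key (Sum.inl y) (Sum.inl y) _ ?_ rfl ?_ <;> exact Fin.ext (by simp [E])
    · refine key (Sum.inr (Sum.inl (Fin.castAdd p' y)))
        (Sum.inr (Sum.inl (blockSwap q p' (Fin.castAdd p' y)))) _ ?_ rfl ?_ <;>
        exact Fin.ext (by simp [E, blockSwap_castAdd, add_assoc])
    · refine key (Sum.inr (Sum.inl (Fin.natAdd q y)))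
        (Sum.inr (Sum.inl (blockSwap q p' (Fin.natAdd q y)))) _ ?_ rfl ?_ <;>
        exact Fin.ext (by simp [E, blockSwap_natAdd, add_assoc])
    · refine key (Sum.inr (Sum.inr y)) (Sum.inr (Sum.inr y)) _ ?_ rfl ?_ <;>
        refine Fin.ext ?_ <;> simp [E] <;> omega
  rw [hE, Equiv.Perm.sign_permCongr, Equiv.Perm.sign_sumCongr, Equiv.Perm.sign_sumCongr,
    sign_blockSwap]
  simp

end BlockSign

/-! ### Alternating products of linear forms -/

section AltProd

variable {k : Type*} [Field k] {M N : Type*} [AddCommGroup M] [Module k M] [AddCommGroup N]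
  [Module k N]
variable {ι κ : Type*} [Fintype ι] [DecidableEq ι] [Fintype κ] [DecidableEq κ]

theorem map_domCoprod {P Q P' Q' : Type*} [AddCommGroup P] [Module k P] [AddCommGroup Q]
    [Module k Q] [AddCommGroup P'] [Module k P'] [AddCommGroup Q'] [Module k Q']
    (f : P →ₗ[k] P') (g : Q →ₗ[k] Q') (a : M [⋀^ι]→ₗ[k] P) (b : M [⋀^κ]→ₗ[k] Q) :
    (TensorProduct.map f g).compAlternatingMap (a.domCoprod b)
      = (f.compAlternatingMap a).domCoprod (g.compAlternatingMap b) := by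
  ext v
  simp only [LinearMap.compAlternatingMap_apply, AlternatingMap.domCoprod_apply,
    sum_apply, map_sum]
  refine Finset.sum_congr rfl fun σ _ => ?_
  induction σ using Quotient.inductionOn' with | _ σ
  rw [AlternatingMap.domCoprod.summand_mk'', AlternatingMap.domCoprod.summand_mk'']
  simp only [smul_apply, MultilinearMap.domDomCongr_apply,
    MultilinearMap.domCoprod_apply, AlternatingMap.coe_multilinearMap,
    LinearMap.compAlternatingMap_apply]
  rw [LinearMap.map_smul_of_tower, TensorProduct.map_tmul]

/-- The exterior product of linear forms, `(v_i) ↦ ∑ σ, (-1)^σ ∏ i, g_i(v_{σ(i)})`. -/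
def altProd (g : ι → Module.Dual k M) : M [⋀^ι]→ₗ[k] k :=
  MultilinearMap.alternatization ((MultilinearMap.mkPiAlgebra k ι k).compLinearMap g)

theorem altProd_apply (g : ι → Module.Dual k M) (v : ι → M) :
    altProd g v = ∑ σ : Equiv.Perm ι, Equiv.Perm.sign σ • ∏ i, g i (v (σ i)) := by
  simp [altProd, MultilinearMap.alternatization_apply]

theorem altProd_compLinearMap (g : ι → Module.Dual k M) (f : N →ₗ[k] M) :
    (altProd g).compLinearMap f = altProd fun i => g i ∘ₗ f := by
  ext v
  simp [altProd_apply]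

theorem altProd_domDomCongr (g : ι → Module.Dual k M) (e : ι ≃ κ) :
    (altProd g).domDomCongr e = altProd (g ∘ e.symm) := by
  ext v
  rw [AlternatingMap.domDomCongr_apply, altProd_apply, altProd_apply,
    ← e.permCongr.sum_comp]
  refine Finset.sum_congr rfl fun σ _ => ?_
  rw [Equiv.Perm.sign_permCongr, ← e.prod_comp]
  simp

theorem altProd_comp_perm (g : ι → Module.Dual k M) (τ : Equiv.Perm ι) :
    altProd (g ∘ τ) = Equiv.Perm.sign τ • altProd g := by
  rw [← Equiv.Perm.sign_symm, ← AlternatingMap.domDomCongr_perm, altProd_domDomCongr,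
    Equiv.symm_symm]

variable (k M ι κ) in
/-- The exterior product of scalar valued alternating maps. -/
def altMul : (M [⋀^ι]→ₗ[k] k) →ₗ[k] (M [⋀^κ]→ₗ[k] k) →ₗ[k] (M [⋀^ι ⊕ κ]→ₗ[k] k) :=
  LinearMap.mk₂ k (fun a b => (LinearMap.mul' k k).compAlternatingMap (a.domCoprod b))
    (fun a a' b => by
      simp only [← AlternatingMap.domCoprod'_apply, TensorProduct.add_tmul, map_add]
      exact AlternatingMap.ext fun v => map_add (LinearMap.mul' k k) _ _)
    (fun c a b => by
      simp only [← AlternatingMap.domCoprod'_apply, ← TensorProduct.smul_tmul', map_smul]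
      exact AlternatingMap.ext fun v => map_smul (LinearMap.mul' k k) _ _)
    (fun a b b' => by
      simp only [← AlternatingMap.domCoprod'_apply, TensorProduct.tmul_add, map_add]
      exact AlternatingMap.ext fun v => map_add (LinearMap.mul' k k) _ _)
    (fun c a b => by
      simp only [← AlternatingMap.domCoprod'_apply, TensorProduct.tmul_smul, map_smul]
      exact AlternatingMap.ext fun v => map_smul (LinearMap.mul' k k) _ _)

theorem altMul_apply (a : M [⋀^ι]→ₗ[k] k) (b : M [⋀^κ]→ₗ[k] k) :
    altMul k M ι κ a b = (LinearMap.mul' k k).compAlternatingMap (a.domCoprod b) := rfl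

/-- Every permutation of `ι ⊕ κ` factors through a shuffle coset and a pair of permutations of `ι`
and `κ`. The shuffle sum of two full antisymmetrizations is thus a full antisymmetrization, with no
factorials. -/
theorem altMul_altProd (g : ι → Module.Dual k M) (g' : κ → Module.Dual k M) :
    altMul k M ι κ (altProd g) (altProd g') = altProd (Sum.elim g g') := by
  rw [altMul_apply, altProd, altProd, ← MultilinearMap.domCoprod_alternization]
  ext v
  simp only [altProd_apply, LinearMap.compAlternatingMap_apply,
    MultilinearMap.alternatization_apply, map_sum, LinearMap.map_smul_of_tower,
    MultilinearMap.domDomCongr_apply, MultilinearMap.domCoprod_apply]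
  simp

end AltProd

/-! ### Scalar cochains -/

section ScalarCochains

variable {k : Type*} [Field k] {n : ℕ}

theorem evalS_ιMulti {p : ℕ} (X : Fin p → sAlg k n) (θ : Fin p → Module.Dual k (sAlg k n)) :
    evalS k n p X (exteriorPower.ιMulti k p θ) = altProd θ X := by
  rw [altProd_apply]
  simp [evalS, Matrix.det_apply]

theorem evalN_tprod_eq_altProd {q : ℕ} (ξ : Fin q → nAlg k n) (f : Fin q → FN k n) :
    evalN k n q ξ (PiTensorProduct.tprod k f) = altProd (fun j => (pairing k n).flip (f j)) ξ := by
  rw [evalN_tprod, altProd_apply]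
  rfl

variable (k n) in
/-- The alternating map on `W_n` with values in `(∧^p 𝔰^*)^* ⊗ (F(N)^{⊗q})^*` that combines
`evalS` and `evalN`. -/
def evalW (p q : ℕ) : W k n [⋀^Fin p ⊕ Fin q]→ₗ[k]
    Module.Dual k (ExtS k n p) ⊗[k] Module.Dual k (⨂[k]^q (FN k n)) :=
  ((evalS k n p).compLinearMap (prS k n)).domCoprod ((evalN k n q).compLinearMap (prN k n))

variable (k n) in
/-- The scalar cochain on `W_n` given by a coefficient in `∧^p 𝔰^* ⊗ F(N)^{⊗q}`. -/
def coch (p q : ℕ) : HopfCoeff k n p q →ₗ[k] (W k n [⋀^Fin p ⊕ Fin q]→ₗ[k] k) where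
  toFun c := ((TensorProduct.dualDistrib k (ExtS k n p) (⨂[k]^q (FN k n))).flip
    c).compAlternatingMap (evalW k n p q)
  map_add' c c' := AlternatingMap.ext fun v =>
    map_add (TensorProduct.dualDistrib k (ExtS k n p) (⨂[k]^q (FN k n)) (evalW k n p q v)) c c'
  map_smul' r c := AlternatingMap.ext fun v =>
    map_smul (TensorProduct.dualDistrib k (ExtS k n p) (⨂[k]^q (FN k n)) (evalW k n p q v)) r c

theorem coch_def {p q : ℕ} (c : HopfCoeff k n p q) :
    coch k n p q c = ((TensorProduct.dualDistrib k (ExtS k n p) (⨂[k]^q (FN k n))).flip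
      c).compAlternatingMap (evalW k n p q) := rfl

/-- On a decomposable coefficient the `𝔰`-part (a determinant) and the `𝔫`-part (the sum over `S_q`)
are both exterior products of linear forms, and the shuffle sum merges them into one. -/
theorem coch_ιMulti_tprod {p q : ℕ} (θ : Fin p → Module.Dual k (sAlg k n)) (f : Fin q → FN k n) :
    coch k n p q (exteriorPower.ιMulti k p θ ⊗ₜ[k] PiTensorProduct.tprod k f)
      = altProd (Sum.elim (fun i => θ i ∘ₗ prS k n)
        fun j => (pairing k n).flip (f j) ∘ₗ prN k n) := by
  have h : (TensorProduct.dualDistrib k (ExtS k n p) (⨂[k]^q (FN k n))).flip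
      (exteriorPower.ιMulti k p θ ⊗ₜ[k] PiTensorProduct.tprod k f)
      = LinearMap.mul' k k ∘ₗ TensorProduct.map
        (Module.Dual.eval k (ExtS k n p) (exteriorPower.ιMulti k p θ))
        (Module.Dual.eval k (⨂[k]^q (FN k n)) (PiTensorProduct.tprod k f)) :=
    TensorProduct.ext' fun a b => rfl
  have hS : (Module.Dual.eval k (ExtS k n p) (exteriorPower.ιMulti k p θ)).compAlternatingMap
      ((evalS k n p).compLinearMap (prS k n)) = altProd fun i => θ i ∘ₗ prS k n := by
    rw [← altProd_compLinearMap]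
    exact AlternatingMap.ext fun v => evalS_ιMulti _ _
  have hN : (Module.Dual.eval k (⨂[k]^q (FN k n)) (PiTensorProduct.tprod k f)).compAlternatingMap
      ((evalN k n q).compLinearMap (prN k n))
      = altProd fun j => (pairing k n).flip (f j) ∘ₗ prN k n := by
    rw [← altProd_compLinearMap (fun j => (pairing k n).flip (f j))]
    exact AlternatingMap.ext fun v => evalN_tprod_eq_altProd _ _
  rw [coch_def, h, ← altMul_altProd, altMul_apply, ← hS, ← hN, ← map_domCoprod]
  rfl

theorem wedge_ιMulti {p p' : ℕ} (θ : Fin p → Module.Dual k (sAlg k n))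
    (θ' : Fin p' → Module.Dual k (sAlg k n)) :
    wedge k n p p' (exteriorPower.ιMulti k p θ) (exteriorPower.ιMulti k p' θ')
      = exteriorPower.ιMulti k (p + p') (Fin.append θ θ') := by
  refine Subtype.ext ?_
  change (exteriorPower.ιMulti k p θ : ExteriorAlgebra k (Module.Dual k (sAlg k n)))
    * (exteriorPower.ιMulti k p' θ' : ExteriorAlgebra k (Module.Dual k (sAlg k n))) = _
  simp only [exteriorPower.ιMulti_apply_coe, ExteriorAlgebra.ιMulti_apply]
  rw [← List.prod_append, ← List.ofFn_fin_append]
  congr 2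
  funext i
  induction i using Fin.addCases <;> simp

theorem span_ιMulti_tprod (p q : ℕ) :
    Submodule.span k {t : HopfCoeff k n p q | ∃ (θ : Fin p → Module.Dual k (sAlg k n))
      (f : Fin q → FN k n), t = exteriorPower.ιMulti k p θ ⊗ₜ[k] PiTensorProduct.tprod k f} = ⊤ := by
  rw [eq_top_iff, ← TensorProduct.span_tmul_eq_top, Submodule.span_le]
  rintro _ ⟨η, g, rfl⟩
  have hη : η ∈ Submodule.span k (Set.range (exteriorPower.ιMulti k p)) :=
    (exteriorPower.ιMulti_span k p (Module.Dual k (sAlg k n))).symm ▸ Submodule.mem_top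
  have hg : g ∈ Submodule.span k (Set.range (PiTensorProduct.tprod k)) :=
    PiTensorProduct.span_tprod_eq_top (R := k) (s := fun _ : Fin q => FN k n).symm ▸
      Submodule.mem_top
  have := Submodule.apply_mem_map₂ (TensorProduct.mk k (ExtS k n p) (⨂[k]^q (FN k n))) hη hg
  rw [Submodule.map₂_span_span] at this
  refine Submodule.span_mono ?_ this
  rintro _ ⟨_, ⟨θ, rfl⟩, _, ⟨f, rfl⟩, rfl⟩
  exact ⟨θ, f, rfl⟩

theorem neg_one_pow_smul {M ι : Type*} [AddCommGroup M] [Module k M] (m : ℕ)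
    (a : M [⋀^ι]→ₗ[k] k) : (-1 : k) ^ m • a = (-1 : ℤˣ) ^ m • a := by
  refine AlternatingMap.ext fun v => ?_
  rw [AlternatingMap.smul_apply, AlternatingMap.smul_apply]
  rcases Nat.even_or_odd m with h | h <;> simp [h.neg_one_pow, Units.smul_def]

/-- This is the source of the sign in `*`: on decomposable coefficients both sides are exterior
products of the same linear forms on `W_n`, with the blocks `f` and `θ'` in opposite order. -/
theorem coch_plainMul {p q p' q' : ℕ} (c : HopfCoeff k n p q) (c' : HopfCoeff k n p' q') :
    (coch k n _ _ (plainMul k n p q p' q' c c')).domDomCongr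
        (finSumFinEquiv.trans (finCongr (Nat.add_add_add_comm p p' q q')))
      = (-1 : k) ^ (q * p') • (altMul k _ _ _ ((coch k n _ _ c).domDomCongr finSumFinEquiv)
        ((coch k n _ _ c').domDomCongr finSumFinEquiv)).domDomCongr finSumFinEquiv := by
  let D {ι κ : Type} (e : ι ≃ κ) :=
    (AlternatingMap.domDomCongrₗ (R := k) (M := W k n) (N := k) k e).toLinearMap
  let L : HopfCoeff k n p q →ₗ[k] HopfCoeff k n p' q' →ₗ[k]
      (W k n [⋀^Fin (p + q + (p' + q'))]→ₗ[k] k) :=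
    (plainMul k n p q p' q').compr₂ (D (finSumFinEquiv.trans
      (finCongr (Nat.add_add_add_comm p p' q q'))) ∘ₗ coch k n _ _)
  let R : HopfCoeff k n p q →ₗ[k] HopfCoeff k n p' q' →ₗ[k]
      (W k n [⋀^Fin (p + q + (p' + q'))]→ₗ[k] k) :=
    (-1 : k) ^ (q * p') • (((altMul k (W k n) _ _).compl₁₂ (D finSumFinEquiv ∘ₗ coch k n p q)
      (D finSumFinEquiv ∘ₗ coch k n p' q')).compr₂ (D finSumFinEquiv))
  -- Both sides are packaged as bilinear maps of `(c, c')`, so that equality can be tested on the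
  -- spanning set of decomposable tensors in each variable.
  suffices L = R from LinearMap.congr_fun₂ this c c'
  refine LinearMap.ext_on (span_ιMulti_tprod p q) ?_
  rintro _ ⟨θ, f, rfl⟩
  refine LinearMap.ext_on (span_ιMulti_tprod p' q') ?_
  rintro _ ⟨θ', g, rfl⟩
  change (coch k n _ _ (plainMul k n p q p' q' _ _)).domDomCongr
        (finSumFinEquiv.trans (finCongr (Nat.add_add_add_comm p p' q q')))
      = (-1 : k) ^ (q * p') • (altMul k _ _ _ ((coch k n _ _ _).domDomCongr finSumFinEquiv)
        ((coch k n _ _ _).domDomCongr finSumFinEquiv)).domDomCongr finSumFinEquiv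
  rw [plainMul_tmul, wedge_ιMulti, mulEquiv_tprod_tprod]
  simp only [coch_ιMulti_tprod, altProd_domDomCongr, altMul_altProd]
  -- The scalar is read as the sign of `middleSwap` and absorbed into the order of the linear forms;
  -- what remains is an equality of two families, checked on each of the four blocks.
  rw [neg_one_pow_smul, ← sign_middleSwap, ← Equiv.Perm.sign_symm, ← altProd_comp_perm]
  congr 1
  funext i
  obtain ⟨y, rfl⟩ : ∃ y, middleSwap p q p' q'
      (finSumFinEquiv (Sum.map finSumFinEquiv finSumFinEquiv y)) = i :=
    (((finSumFinEquiv.sumCongr finSumFinEquiv).trans finSumFinEquiv).trans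
      (middleSwap p q p' q')).surjective i
  rw [Function.comp_apply, Function.comp_apply, Equiv.symm_apply_apply, middleSwap_apply,
    Equiv.symm_apply_apply, Function.comp_apply, Equiv.symm_apply_apply]
  rcases y with (y | y) | (y | y) <;> simp

end ScalarCochains

/-! ### Cochains on `W_n` and the total complex -/

section Total

variable {k : Type*} [Field k] {n : ℕ}

theorem prS_of_mem_sAlg (X : sAlg k n) : prS k n X.1 = X := by
  refine Subtype.ext (funext fun i => MvPowerSeries.ext fun K => ?_)
  change (if K.degree < 2 then MvPowerSeries.coeff K (X.1 i) else 0) = _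
  split_ifs with h
  · rfl
  · exact (X.2 i K (not_lt.mp h)).symm

theorem prN_of_mem_nAlg (ξ : nAlg k n) : prN k n ξ.1 = ξ := by
  refine Subtype.ext (funext fun i => MvPowerSeries.ext fun K => ?_)
  change (if 2 ≤ K.degree then MvPowerSeries.coeff K (ξ.1 i) else 0) = _
  split_ifs with h
  · rfl
  · exact (ξ.2 i K (not_le.mp h)).symm

theorem prS_of_mem_nAlg (ξ : nAlg k n) : prS k n ξ.1 = 0 := by
  refine Subtype.ext (funext fun i => MvPowerSeries.ext fun K => ?_)
  change (if K.degree < 2 then MvPowerSeries.coeff K (ξ.1 i) else 0) = 0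
  split_ifs with h
  · exact ξ.2 i K h
  · rfl

theorem prN_of_mem_sAlg (X : sAlg k n) : prN k n X.1 = 0 := by
  refine Subtype.ext (funext fun i => MvPowerSeries.ext fun K => ?_)
  change (if 2 ≤ K.degree then MvPowerSeries.coeff K (X.1 i) else 0) = 0
  split_ifs with h
  · exact X.2 i K h
  · rfl

variable (k n) in
/-- The shuffle sum of `(X_{σ(1)} ∧ ⋯ ∧ X_{σ(p)}) ⊗ (ξ_{σ(p+1)} ∧ ⋯ ∧ ξ_{σ(p+q)})`. -/
def shuffleTensor (p q : ℕ) : W k n [⋀^Fin p ⊕ Fin q]→ₗ[k]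
    (⋀[k]^p (sAlg k n)) ⊗[k] ⋀[k]^q (nAlg k n) :=
  ((exteriorPower.ιMulti k p).compLinearMap (prS k n)).domCoprod
    ((exteriorPower.ιMulti k q).compLinearMap (prN k n))

theorem naturalInv_def {p q : ℕ} (Φ : BiC k n p q) :
    naturalInv Φ = ((TensorProduct.lift (exteriorPower.alternatingMapLinearEquiv.toLinearMap ∘ₗ
      exteriorPower.alternatingMapLinearEquiv Φ)).compAlternatingMap
        (shuffleTensor k n p q)).domDomCongr finSumFinEquiv := rfl

variable (k n) in
/-- The coefficient of a form at `(o, K)`. -/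
def formCoeff (o : Option (Fin n)) (K : Fin n →₀ ℕ) : Forms n k →ₗ[k] k :=
  LinearMap.proj K ∘ₗ LinearMap.proj o

theorem formCoeff_apply (o : Option (Fin n)) (K : Fin n →₀ ℕ) (ω : Forms n k) :
    formCoeff k n o K ω = ω o K := rfl

/-- Both sides are linear functionals applied to the same `shuffleTensor`, so they need only agree
on `(X_1 ∧ ⋯ ∧ X_p) ⊗ (ξ_1 ∧ ⋯ ∧ ξ_q)`, where both unfold to the formula for `𝒱`. -/
theorem formCoeff_naturalInv_vanEst {p q : ℕ} (x : HopfC k n p q) (o : Option (Fin n))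
    (K : Fin n →₀ ℕ) : (formCoeff k n o K).compAlternatingMap (naturalInv (vanEst x))
      = (coch k n p q (x o K)).domDomCongr finSumFinEquiv := by
  have hW : evalW k n p q = (TensorProduct.map (exteriorPower.pairingDual k (sAlg k n) p).flip
      (exteriorPower.alternatingMapLinearEquiv (evalN k n q))).compAlternatingMap
        (shuffleTensor k n p q) := by
    rw [shuffleTensor, map_domCoprod, evalW]
    congr 1
    ext1 v
    simp
  have hL : formCoeff k n o K ∘ₗ
      TensorProduct.lift (exteriorPower.alternatingMapLinearEquiv.toLinearMap ∘ₗ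
        exteriorPower.alternatingMapLinearEquiv (vanEst x))
      = (TensorProduct.dualDistrib k (ExtS k n p) (⨂[k]^q (FN k n))).flip (x o K) ∘ₗ
        TensorProduct.map (exteriorPower.pairingDual k (sAlg k n) p).flip
          (exteriorPower.alternatingMapLinearEquiv (evalN k n q)) := by
    refine TensorProduct.ext (exteriorPower.linearMap_ext (AlternatingMap.ext fun X =>
      exteriorPower.linearMap_ext (AlternatingMap.ext fun ξ => ?_)))
    simp only [LinearMap.compAlternatingMap_apply, LinearMap.compr₂ₛₗ_apply, TensorProduct.mk_apply,
      LinearMap.comp_apply, TensorProduct.lift.tmul, TensorProduct.map_tmul,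
      exteriorPower.alternatingMapLinearEquiv_apply_ιMulti, LinearEquiv.coe_coe, formCoeff_apply]
    rfl
  rw [coch_def, hW, naturalInv_def]
  refine AlternatingMap.ext fun v => ?_
  exact LinearMap.congr_fun hL (shuffleTensor k n p q (v ∘ finSumFinEquiv))

theorem alternatingMap_sum_apply {M N ι κ : Type*} [AddCommGroup M] [Module k M]
    [AddCommGroup N] [Module k N] (s : Finset κ) (a : κ → M [⋀^ι]→ₗ[k] N) (v : ι → M) :
    (∑ i ∈ s, a i) v = ∑ i ∈ s, a i v := by
  classical
  induction s using Finset.induction_on with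
  | empty => simp
  | insert i s hi ih => rw [Finset.sum_insert hi, Finset.sum_insert hi, AlternatingMap.add_apply, ih]

/-- Shuffle sums commute with linear maps on the values, so the cup product of form-valued cochains
reduces to `altMul` of scalar ones, summed as in the product of power series. -/
theorem formCoeff_none_cup {p q : ℕ} (c : LieC k n p) (c' : LieC k n q) (L : Fin n →₀ ℕ) :
    (formCoeff k n none L).compAlternatingMap (c.cup c')
      = ∑ KM ∈ Finset.HasAntidiagonal.antidiagonal L,
        (altMul k _ _ _ ((formCoeff k n none KM.1).compAlternatingMap c)
          ((formCoeff k n none KM.2).compAlternatingMap c')).domDomCongr finSumFinEquiv := by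
  have hL : formCoeff k n none L ∘ₗ TensorProduct.lift (formsMul k n)
      = ∑ KM ∈ Finset.HasAntidiagonal.antidiagonal L, LinearMap.mul' k k ∘ₗ
        TensorProduct.map (formCoeff k n none KM.1) (formCoeff k n none KM.2) := by
    refine TensorProduct.ext' fun a b => ?_
    simp only [LinearMap.sum_apply, LinearMap.comp_apply, TensorProduct.map_tmul]
    rfl
  refine AlternatingMap.ext fun v => ?_
  refine (LinearMap.congr_fun hL (c.domCoprod c' (v ∘ finSumFinEquiv))).trans ?_
  rw [LinearMap.sum_apply, alternatingMap_sum_apply]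
  refine Finset.sum_congr rfl fun KM _ => ?_
  rw [altMul_apply, ← map_domCoprod]
  rfl

theorem formCoeff_some_cup {p q : ℕ} (c : LieC k n p) (c' : LieC k n q) (j : Fin n)
    (L : Fin n →₀ ℕ) :
    (formCoeff k n (some j) L).compAlternatingMap (c.cup c')
      = ∑ KM ∈ Finset.HasAntidiagonal.antidiagonal L,
        ((altMul k _ _ _ ((formCoeff k n none KM.1).compAlternatingMap c)
          ((formCoeff k n (some j) KM.2).compAlternatingMap c')).domDomCongr finSumFinEquiv
        + (altMul k _ _ _ ((formCoeff k n (some j) KM.1).compAlternatingMap c)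
          ((formCoeff k n none KM.2).compAlternatingMap c')).domDomCongr finSumFinEquiv) := by
  have hL : formCoeff k n (some j) L ∘ₗ TensorProduct.lift (formsMul k n)
      = ∑ KM ∈ Finset.HasAntidiagonal.antidiagonal L, (LinearMap.mul' k k ∘ₗ
        TensorProduct.map (formCoeff k n none KM.1) (formCoeff k n (some j) KM.2)
        + LinearMap.mul' k k ∘ₗ
        TensorProduct.map (formCoeff k n (some j) KM.1) (formCoeff k n none KM.2)) := by
    refine TensorProduct.ext' fun a b => ?_
    simp only [LinearMap.sum_apply, LinearMap.add_apply, LinearMap.comp_apply,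
      TensorProduct.map_tmul]
    rfl
  refine AlternatingMap.ext fun v => ?_
  refine (LinearMap.congr_fun hL (c.domCoprod c' (v ∘ finSumFinEquiv))).trans ?_
  rw [LinearMap.sum_apply, alternatingMap_sum_apply]
  refine Finset.sum_congr rfl fun KM _ => ?_
  rw [altMul_apply, altMul_apply, ← map_domCoprod, ← map_domCoprod]
  rfl

/-- The comparison of the cup product of cochains on `W_n` with the untwisted product. -/
theorem naturalInv_vanEst_star {p q p' q' : ℕ} (x : HopfC k n p q) (y : HopfC k n p' q')
    (hy : y.IsNormalized) :
    LieC.cup (naturalInv (vanEst x)) (naturalInv (vanEst y))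
      = (naturalInv (vanEst (x.star y))).domDomCongr
        (finCongr (Nat.add_add_add_comm p p' q q')) := by
  -- This is `coch_plainMul` solved for the other side, the sign being its own inverse.
  have hc (c : HopfCoeff k n p q) (c' : HopfCoeff k n p' q') :
      (altMul k _ _ _ ((coch k n _ _ c).domDomCongr finSumFinEquiv)
        ((coch k n _ _ c').domDomCongr finSumFinEquiv)).domDomCongr finSumFinEquiv
      = (-1 : k) ^ (q * p') • (coch k n _ _ (plainMul k n p q p' q' c c')).domDomCongr
        (finSumFinEquiv.trans (finCongr (Nat.add_add_add_comm p p' q q'))) := by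
    rw [coch_plainMul, smul_smul, ← mul_pow]
    simp
  have hstar : vanEst (x.star y)
      = vanEst ((-1 : k) ^ (q * p') •
        (Forms.mul (plainMul k n p q p' q') x y : HopfC k n (p + p') (q + q'))) := by
    have hs (z : HopfC k n (p + p') (q + q')) : vanEst ((-1 : k) ^ (q * p') • z)
        = (-1 : k) ^ (q * p') • vanEst z :=
      AlternatingMap.ext fun X => AlternatingMap.ext fun ξ => funext fun o => funext fun K =>
        map_smul (TensorProduct.dualDistrib k (ExtS k n (p + p')) (⨂[k]^(q + q') (FN k n))
          (evalS k n _ X ⊗ₜ[k] evalN k n _ ξ)) _ _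
    rw [HopfC.star, hs, hs, vanEst_cup x y hy]
  rw [hstar]
  have hext {m : ℕ} (c c' : LieC k n m) (h : ∀ o K, (formCoeff k n o K).compAlternatingMap c
      = (formCoeff k n o K).compAlternatingMap c') : c = c' :=
    AlternatingMap.ext fun v => funext fun o => funext fun K => DFunLike.congr_fun (h o K) v
  refine hext _ _ fun o L => ?_
  have hr := congrArg (AlternatingMap.domDomCongr
    (finCongr (Nat.add_add_add_comm p p' q q'))) (formCoeff_naturalInv_vanEst
      ((-1 : k) ^ (q * p') •
        (Forms.mul (plainMul k n p q p' q') x y : HopfC k n (p + p') (q + q'))) o L)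
  refine Eq.trans ?_ hr.symm
  rw [← AlternatingMap.domDomCongr_trans, Pi.smul_apply, Pi.smul_apply, map_smul]
  cases o with
  | none =>
    simp only [formCoeff_none_cup, formCoeff_naturalInv_vanEst, hc, Forms.mul, map_sum]
    refine AlternatingMap.ext fun v => ?_
    simp [alternatingMap_sum_apply, Finset.mul_sum]
  | some j =>
    simp only [formCoeff_some_cup, formCoeff_naturalInv_vanEst, hc, Forms.mul, map_sum, map_add]
    refine AlternatingMap.ext fun v => ?_
    simp [alternatingMap_sum_apply, Finset.mul_sum, mul_add]

end Total

/-! ### ### `♮` after `♮⁻¹` in each bidegree -/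

section Natural

variable {k : Type*} [Field k] {n : ℕ}

theorem lift_shuffleTensor {p q : ℕ} (Φ : BiC k n p q) (w : Fin p ⊕ Fin q → W k n) :
    TensorProduct.lift (exteriorPower.alternatingMapLinearEquiv.toLinearMap ∘ₗ
      exteriorPower.alternatingMapLinearEquiv Φ) (shuffleTensor k n p q w)
      = ∑ σ : Equiv.Perm.ModSumCongr (Fin p) (Fin q), TensorProduct.lift
        (exteriorPower.alternatingMapLinearEquiv.toLinearMap ∘ₗ
          exteriorPower.alternatingMapLinearEquiv Φ)
        (AlternatingMap.domCoprod.summand ((exteriorPower.ιMulti k p).compLinearMap (prS k n))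
          ((exteriorPower.ιMulti k q).compLinearMap (prN k n)) σ w) := by
  rw [shuffleTensor, AlternatingMap.domCoprod_apply, sum_apply, map_sum]

theorem lift_summand {p q : ℕ} (Φ : BiC k n p q) (w : Fin p ⊕ Fin q → W k n)
    (σ : Equiv.Perm (Fin p ⊕ Fin q)) :
    TensorProduct.lift (exteriorPower.alternatingMapLinearEquiv.toLinearMap ∘ₗ
      exteriorPower.alternatingMapLinearEquiv Φ)
        (AlternatingMap.domCoprod.summand ((exteriorPower.ιMulti k p).compLinearMap (prS k n))
          ((exteriorPower.ιMulti k q).compLinearMap (prN k n)) (Quotient.mk'' σ) w)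
      = Equiv.Perm.sign σ • Φ (fun i => prS k n (w (σ (Sum.inl i))))
        (fun j => prN k n (w (σ (Sum.inr j)))) := by
  rw [AlternatingMap.domCoprod.summand_mk'', smul_apply,
    LinearMap.map_smul_of_tower, MultilinearMap.domDomCongr_apply, MultilinearMap.domCoprod_apply,
    TensorProduct.lift.tmul]
  congr 1
  change exteriorPower.alternatingMapLinearEquiv (exteriorPower.alternatingMapLinearEquiv Φ
    (exteriorPower.ιMulti k p _)) (exteriorPower.ιMulti k q _) = _
  rw [exteriorPower.alternatingMapLinearEquiv_apply_ιMulti,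
    exteriorPower.alternatingMapLinearEquiv_apply_ιMulti]

theorem apply_pr_eq_zero {p q : ℕ} (Φ : BiC k n p q) (w : Fin p ⊕ Fin q → W k n)
    (h : (∃ i, prS k n (w (Sum.inl i)) = 0) ∨ ∃ j, prN k n (w (Sum.inr j)) = 0) :
    Φ (fun i => prS k n (w (Sum.inl i))) (fun j => prN k n (w (Sum.inr j))) = 0 := by
  rcases h with ⟨i, hi⟩ | ⟨j, hj⟩
  · rw [Φ.map_coord_zero i hi, AlternatingMap.zero_apply]
  · exact AlternatingMap.map_coord_zero _ j hj

/-- A permutation outside the trivial coset puts some `ξ_j` into an `𝔰`-slot, where `prS` kills it.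
Only the identity shuffle contributes. -/
theorem lift_shuffleTensor_sumElim {p q : ℕ} (Φ : BiC k n p q) (X : Fin p → sAlg k n)
    (ξ : Fin q → nAlg k n) :
    TensorProduct.lift (exteriorPower.alternatingMapLinearEquiv.toLinearMap ∘ₗ
      exteriorPower.alternatingMapLinearEquiv Φ) (shuffleTensor k n p q
        (Sum.elim (fun i => (X i : W k n)) fun j => (ξ j : W k n))) = Φ X ξ := by
  rw [lift_shuffleTensor]
  refine (Finset.sum_eq_single
    (Quotient.mk'' 1 : Equiv.Perm.ModSumCongr (Fin p) (Fin q)) ?_ (by simp)).trans ?_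
  · intro σ _ hσ
    induction σ using Quotient.inductionOn' with | _ σ
    rw [lift_summand, apply_pr_eq_zero Φ (fun i => Sum.elim (fun i => (X i : W k n))
      (fun j => (ξ j : W k n)) (σ i)), smul_zero]
    refine Or.inl ?_
    -- If no `𝔰`-slot vanishes, `σ` maps the left summand to itself, hence preserves both summands
    -- and lies in the trivial coset.
    by_contra! h
    refine hσ (Quotient.sound' ?_)
    rw [QuotientGroup.leftRel_apply, mul_one]
    refine inv_mem (Equiv.Perm.mem_sumCongrHom_range_of_perm_mapsTo_inl ?_)
    rintro _ ⟨i, rfl⟩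
    have hi := h i
    rcases hs : σ (Sum.inl i) with j | j
    · exact ⟨j, rfl⟩
    · rw [hs] at hi
      exact absurd (prS_of_mem_nAlg (ξ j)) hi
  · rw [lift_summand]
    simp [prS_of_mem_sAlg, prN_of_mem_nAlg]

/-- A nonzero summand would need every `𝔰`-slot filled by some `X` and every `𝔫`-slot by some `ξ`.
Injectivity then gives `p ≤ r` and `q ≤ s`, and `p + q = r + s` forces `p = r`. -/
theorem lift_shuffleTensor_sumElim_of_ne {p q r s : ℕ} (Φ : BiC k n p q)
    (e : Fin p ⊕ Fin q ≃ Fin r ⊕ Fin s) (hr : p ≠ r) (X : Fin r → sAlg k n)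
    (ξ : Fin s → nAlg k n) :
    TensorProduct.lift (exteriorPower.alternatingMapLinearEquiv.toLinearMap ∘ₗ
      exteriorPower.alternatingMapLinearEquiv Φ) (shuffleTensor k n p q
        (Sum.elim (fun i => (X i : W k n)) (fun j => (ξ j : W k n)) ∘ e)) = 0 := by
  rw [lift_shuffleTensor]
  refine Finset.sum_eq_zero fun σ _ => ?_
  induction σ using Quotient.inductionOn' with | _ σ
  rw [lift_summand, apply_pr_eq_zero Φ (fun i => (Sum.elim (fun i => (X i : W k n))
    (fun j => (ξ j : W k n)) ∘ e) (σ i)), smul_zero]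
  by_contra! h
  have hl (i : Fin p) : ∃ i', (σ.trans e) (Sum.inl i) = Sum.inl i' := by
    have hi := h.1 i
    rcases hs : (σ.trans e) (Sum.inl i) with j | j
    · exact ⟨j, rfl⟩
    · rw [Equiv.trans_apply] at hs
      rw [Function.comp_apply, hs] at hi
      exact absurd (prS_of_mem_nAlg (ξ j)) hi
  have hrr (i : Fin q) : ∃ i', (σ.trans e) (Sum.inr i) = Sum.inr i' := by
    have hi := h.2 i
    rcases hs : (σ.trans e) (Sum.inr i) with j | j
    · rw [Equiv.trans_apply] at hs
      rw [Function.comp_apply, hs] at hi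
      exact absurd (prN_of_mem_sAlg (X j)) hi
    · exact ⟨j, rfl⟩
  choose a ha using hl
  choose b hb using hrr
  have h1 : p ≤ r := by
    simpa using Fintype.card_le_of_injective a fun i j hij =>
      Sum.inl_injective ((σ.trans e).injective ((ha i).trans (hij ▸ (ha j).symm)))
  have h2 : q ≤ s := by
    simpa using Fintype.card_le_of_injective b fun i j hij =>
      Sum.inr_injective ((σ.trans e).injective ((hb i).trans (hij ▸ (hb j).symm)))
  have h3 : p + q = r + s := by simpa using Fintype.card_congr e
  omega

/-- In the bidegree `(p, q)` only the identity shuffle survives and returns `Φ`; in every other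
bidegree of the same total degree all summands vanish. -/
theorem natural_naturalInv {p q : ℕ} (Φ : BiC k n p q) :
    natural (naturalInv Φ) = Φ.toTot rfl := by
  funext ⟨⟨r, s⟩, hrs⟩
  have hm : r + s = p + q := Finset.HasAntidiagonal.mem_antidiagonal.mp hrs
  have hnat (X : Fin r → sAlg k n) (ξ : Fin s → nAlg k n) :
      natural (naturalInv Φ) ⟨(r, s), hrs⟩ X ξ
        = TensorProduct.lift (exteriorPower.alternatingMapLinearEquiv.toLinearMap ∘ₗ
          exteriorPower.alternatingMapLinearEquiv Φ) (shuffleTensor k n p q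
            (Sum.elim (fun i => (X i : W k n)) (fun j => (ξ j : W k n)) ∘
              (finSumFinEquiv.trans (finSumFinEquiv.trans (finCongr hm)).symm))) := rfl
  refine AlternatingMap.ext fun X => AlternatingMap.ext fun ξ => ?_
  rw [hnat]
  by_cases hr : p = r
  · subst hr
    obtain rfl : s = q := by omega
    have he : (finSumFinEquiv.trans (finSumFinEquiv.trans (finCongr hm)).symm :
        Fin p ⊕ Fin s ≃ Fin p ⊕ Fin s) = Equiv.refl _ := by
      refine Equiv.ext fun i => ?_
      rw [Equiv.trans_apply, Equiv.symm_apply_eq]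
      rfl
    rw [he, Equiv.coe_refl, Function.comp_id, lift_shuffleTensor_sumElim, BiC.toTot,
      Pi.single_eq_same]
  · rw [lift_shuffleTensor_sumElim_of_ne Φ _ hr, BiC.toTot, Pi.single_eq_of_ne]
    · rfl
    · intro h
      exact hr (congrArg (fun t => t.1.1) h).symm

theorem natural_domDomCongr_naturalInv {p q m : ℕ} (Φ : BiC k n p q) (h : p + q = m) :
    natural ((naturalInv Φ).domDomCongr (finCongr h)) = Φ.toTot h := by
  subst h
  exact natural_naturalInv Φ

end Natural

end VanEst

end
theorem theorem5p2 (k : Type*) [Field k] [CharZero k] (n p q p' q' : ℕ)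
    (x : VanEst.HopfC k n p q) (y : VanEst.HopfC k n p' q') (hy : y.IsNormalized) :
    (VanEst.vanEst (x.star y)).toTot (Nat.add_add_add_comm p p' q q')
      = (VanEst.vanEst x).cup (VanEst.vanEst y) := by
  rw [VanEst.BiC.cup, VanEst.naturalInv_vanEst_star x y hy,
    VanEst.natural_domDomCongr_naturalInv]
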